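/- **Setting.** Let $d\ge 1$, $k\ge 2$, let $D\subset\mathbb R^d$ be a bounded, open, connected, nonempty set with $C^k$ boundary, and let $T>0$. Let $f:\mathbb R\to\mathbb R$ be of class $C^{k-2}$ and globally Lipschitz, $|f(v)-f(w)|\le C_f|v-w|$ for all $v,w\in\mathbb R$. Let $\bar u\in C^k(\bar D)$, and let $u\in C^k(\bar D\times[0,T])$ be the classical solution of $$u_t=\Delta u+f(u)\ \text{ in } D\times(0,T),\qquad u(x,0)=\bar u(x)\ (x\in D),\qquad u(x,t)=0\ (x\in\partial D,\ t\in(0,T)).$$ Let $u^*=u_{\theta^*}:\mathbb R^{d}\times\mathbb R\to\mathbb R$ be a fully connected feedforward neural network $u_\theta=C_K\circ\sigma\circ C_{K-1}\circ\dots\circ\sigma\circ C_1$ in the variables $(x,t)$, where each $C_i$ is affine, $\sigma\in C^k(\mathbb R)$ acts componentwise, and $\theta^*$ is any choice of the weights and biases (for instance one found by training). Define the residuals $$\mathcal R_{int}=\partial_t u^*-\Delta u^*-f(u^*),\qquad \mathcal R_{sb}=u^*|_{\partial D\times[0,T]},\qquad \mathcal R_{tb}=u^*(\cdot,0)-\bar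 u .$$ **Quadrature.** Let $N_{tb},N_{sb},N_{int}\ge 1$ and $\alpha_{tb},\alpha_{sb},\alpha_{int}>0$. Let points $x_n\in D$ with weights $w_n^{tb}\ge 0$ ($n\le N_{tb}$), points $(x_n,t_n)\in\partial D\times[0,T]$ with weights $w_n^{sb}\ge0$ ($n\le N_{sb}$), points $(x_n,t_n)\in D\times(0,T)$ with weights $w_n^{int}\ge0$ ($n\le N_{int}$), and functions $C^{tb}_{quad},C^{sb}_{quad},C^{int}_{quad}:\mathbb R\to\mathbb R$ be given such that $$\Big|\int_D g\,dx-\sum_{n} w^{tb}_n g(x_n)\Big|\le C^{tb}_{quad}(\|g\|_{C^k})\,N_{tb}^{-\alpha_{tb}}\quad\text{for all } g\in C^k(\bar D),$$ $$\Big|\int_0^T\!\!\int_{\partial D} g\,ds\,dt-\sum_{n} w^{sb}_n g(x_n,t_n)\Big|\le C^{sb}_{quad}(\|g\|_{C^k})\,N_{sb}^{-\alpha_{sb}}\quad\text{for all } g\in C^k(\partial D\times[0,T]),$$ $$\Big|\int_0^T\!\!\int_{D} g\,dx\,dt-\sum_{n} w^{int}_n g(x_n,t_n)\Big|\le C^{int}_{quad}(\|g\|_{C^{k-2}})\,N_{int}^{-\alpha_{int}}\quad\text{for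 all } g\in C^{k-2}(\bar D\times[0,T]).$$ Define the training errors $$\mathcal E_T^{tb}=\Big(\sum_n w_n^{tb}|\mathcal R_{tb}(x_n)|^2\Big)^{1/2},\quad \mathcal E_T^{sb}=\Big(\sum_n w_n^{sb}|\mathcal R_{sb}(x_n,t_n)|^2\Big)^{1/2},\quad \mathcal E_T^{int}=\Big(\sum_n w_n^{int}|\mathcal R_{int}(x_n,t_n)|^2\Big)^{1/2}.$$ **Theorem 3.1.** The error $\mathcal E_G=\big(\int_0^T\int_D|u-u^*|^2\,dx\,dt\big)^{1/2}$ satisfies $$\mathcal E_G\le C_1\Big(\mathcal E_T^{tb}+\mathcal E_T^{int}+C_2(\mathcal E_T^{sb})^{1/2}+(C^{tb}_{quad})^{1/2}N_{tb}^{-\alpha_{tb}/2}+(C^{int}_{quad})^{1/2}N_{int}^{-\alpha_{int}/2}+C_2\,(C^{sb}_{quad})^{1/4}N_{sb}^{-\alpha_{sb}/4}\Big),$$ where $$C_1=\sqrt{T+(1+2C_f)T^2e^{(1+2C_f)T}},\qquad C_2=\sqrt{C_{\partial D}\,T^{1/2}},$$ $$C_{\partial D}=|\partial D|^{1/2}\big(\|u\|_{C^1([0,T]\times\partial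 D)}+\|u^*\|_{C^1([0,T]\times\partial D)}\big),$$ and $C^{tb}_{quad}=C^{tb}_{quad}(\|\mathcal R_{tb}^2\|_{C^k})$, $C^{sb}_{quad}=C^{sb}_{quad}(\|\mathcal R_{sb}^2\|_{C^k})$, $C^{int}_{quad}=C^{int}_{quad}(\|\mathcal R_{int}^2\|_{C^{k-2}})$. Here $\|v\|_{C^1([0,T]\times\partial D)}$ is the supremum of $|v|$ plus the supremum of the norm of the full space-time derivative of $v$ (normal component included) over $\partial D\times[0,T]$, namely $|\nabla_x v|+|\partial_t v|$. -/

import Mathlib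

noncomputable section

namespace HeatPINN

/-- The Euclidean space `ℝ^d`. -/
abbrev Pt (d : ℕ) : Type := EuclideanSpace ℝ (Fin d)

/-! ### Domains, surface measure, spaces of `C^k` functions -/

/-- The set `D ⊆ ℝ^d` has a `C^k` boundary: near each of its boundary points and after a linear
isometric change of coordinates `ℝ^d ≃ ℝ^(d-1) × ℝ` it is the region strictly above the graph
of a `C^k` function `γ`. -/
def HasCkBoundary {d : ℕ} (k : ℕ) (D : Set (Pt d)) : Prop :=
  ∀ x ∈ frontier D, ∃ r : ℝ, 0 < r ∧
    ∃ (e : Pt d ≃ₗᵢ[ℝ] WithLp 2 (Pt (d - 1) × ℝ)) (γ : Pt (d - 1) → ℝ),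
      ContDiff ℝ k γ ∧ ∀ y ∈ Metric.ball x r, (y ∈ D ↔ γ (e y).fst < (e y).snd)

/-- The surface measure `ds` on `∂D`: the `(d-1)`-dimensional Hausdorff measure, normalized so
as to agree with Lebesgue measure on `ℝ^(d-1)`, restricted to the boundary. -/
def surfaceMeasure {d : ℕ} (D : Set (Pt d)) : MeasureTheory.Measure (Pt d) :=
  (MeasureTheory.Measure.euclideanHausdorffMeasure (d - 1)).restrict (frontier D)

/-- The closed space-time cylinder `D̄ × [0,T]`; points are written `(x, t)`. -/
def cyl {d : ℕ} (D : Set (Pt d)) (T : ℝ) : Set (Pt d × ℝ) := closure D ×ˢ Set.Icc 0 T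

/-- The closed lateral boundary `∂D × [0,T]`. -/
def lateral {d : ℕ} (D : Set (Pt d)) (T : ℝ) : Set (Pt d × ℝ) := frontier D ×ˢ Set.Icc 0 T

section Norms

variable {V : Type*} [NormedAddCommGroup V] [NormedSpace ℝ V]

/-- The `C^k` norm over `A ⊆ S` of a function `g` that is of class `C^k` on `S`:
`∑_{j ≤ k} sup_{z ∈ A} ‖D^j g (z)‖`, the derivatives being taken within `S`
(on the boundary of `S` they are the continuous extensions of the derivatives from inside).
For `A = S` this is the usual norm of `C^k(S)`. -/
def ckNorm (k : ℕ) (S A : Set V) (g : V → ℝ) : ℝ :=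
  ∑ j ∈ Finset.range (k + 1), ⨆ z : A, ‖iteratedFDerivWithin ℝ j g S (z : V)‖

/-- `g` is of class `C^k` on the (hyper)surface `A`: it is on `A` the restriction of a `C^k`
function on the ambient space. -/
def IsCkOnSurface (k : ℕ) (A : Set V) (g : V → ℝ) : Prop :=
  ∃ G : V → ℝ, ContDiff ℝ k G ∧ Set.EqOn G g A

/-- The intrinsic norm of `C^k(A)` for a (hyper)surface `A`: the infimum, over all `C^k` functions
`G` on the ambient space that agree with `g` on `A`, of `∑_{j ≤ k} sup_A ‖D^j G‖`. It depends on the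
values of `g` on `A` only. -/
def surfaceCkNorm (k : ℕ) (A : Set V) (g : V → ℝ) : ℝ :=
  sInf {M : ℝ | ∃ G : V → ℝ, ContDiff ℝ k G ∧ Set.EqOn G g A ∧ M = ckNorm k Set.univ A G}

end Norms

/-! ### The semilinear heat equation -/

/-- `u` satisfies, pointwise, `u_t = Δu + f(u)` in `D × (0,T)`, `u = ubar` on `D × {0}` and `u = 0`
on `∂D × (0,T)`. (For a classical solution, smoothness of `u` is required in addition.) -/
structure SolvesHeat {d : ℕ} (D : Set (Pt d)) (T : ℝ) (f : ℝ → ℝ) (ubar : Pt d → ℝ)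
    (u : Pt d × ℝ → ℝ) : Prop where
  pde : ∀ x ∈ D, ∀ t ∈ Set.Ioo 0 T,
    deriv (fun s => u (x, s)) t = Laplacian.laplacian (fun y => u (y, t)) x + f (u (x, t))
  initial : ∀ x ∈ D, u (x, 0) = ubar x
  boundary : ∀ x ∈ frontier D, ∀ t ∈ Set.Ioo 0 T, u (x, t) = 0

/-! ### Neural networks -/

/-- The parameters `θ` (weights and biases of all layers) of a fully connected feedforward network
with `n` inputs and `m` outputs, of arbitrary depth and widths. -/
inductive Net : ℕ → ℕ → Type
  | output {n m : ℕ} (W : Matrix (Fin m) (Fin n) ℝ) (b : Fin m → ℝ) : Net n m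
  | hidden {n p m : ℕ} (W : Matrix (Fin p) (Fin n) ℝ) (b : Fin p → ℝ) (rest : Net p m) : Net n m

/-- The function `C_K ∘ σ ∘ C_{K-1} ∘ ⋯ ∘ σ ∘ C_1` given by the parameters, where
`C_i z = W_i z + b_i` and the activation function `σ` acts componentwise. -/
def Net.eval (σ : ℝ → ℝ) : {n m : ℕ} → Net n m → (Fin n → ℝ) → (Fin m → ℝ)
  | _, _, .output W b, z => W.mulVec z + b
  | _, _, .hidden W b rest, z => rest.eval σ (fun i => σ ((W.mulVec z + b) i))

/-- The network as a scalar function of `(x, t) = (x_1, …, x_d, t)`. -/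
def Net.fn {d : ℕ} (σ : ℝ → ℝ) (θ : Net (d + 1) 1) (z : Pt d × ℝ) : ℝ :=
  θ.eval σ (Fin.snoc (α := fun _ => ℝ) (fun i => z.1 i) z.2) 0

/-! ### Residuals, errors, constants -/

/-- Interior residual `∂_t v - Δ v - f(v)`. -/
def resInt {d : ℕ} (f : ℝ → ℝ) (v : Pt d × ℝ → ℝ) (z : Pt d × ℝ) : ℝ :=
  deriv (fun s => v (z.1, s)) z.2 - Laplacian.laplacian (fun y => v (y, z.2)) z.1 - f (v z)

/-- Spatial boundary residual. -/
def resSb {d : ℕ} (v : Pt d × ℝ → ℝ) (z : Pt d × ℝ) : ℝ := v z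

/-- Temporal boundary residual `v(·,0) - ubar`. -/
def resTb {d : ℕ} (ubar : Pt d → ℝ) (v : Pt d × ℝ → ℝ) (x : Pt d) : ℝ := v (x, 0) - ubar x

/-- The training error `(∑_n w_n |R(y_n)|²)^{1/2}` for a residual `R`. -/
def trainErr {Z : Type*} {N : ℕ} (y : Fin N → Z) (w : Fin N → ℝ) (R : Z → ℝ) : ℝ :=
  √(∑ n, w n * |R (y n)| ^ 2)

/-- The generalization error `(∫_0^T ∫_D |u - v|² dx dt)^{1/2}`. -/
def genErr {d : ℕ} (D : Set (Pt d)) (T : ℝ) (u v : Pt d × ℝ → ℝ) : ℝ :=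
  √(∫ t in (0 : ℝ)..T, ∫ x in D, |u (x, t) - v (x, t)| ^ 2)

/-- The quadrature rule with points `y_n` and weights `w_n`, `1 ≤ n ≤ N`, approximates the integral
`I g` with error at most `C(‖g‖) N^{-α}`, for all functions `g` of the class `F` normed by `nrm`. -/
def QuadBound {Z : Type*} {N : ℕ} (I : (Z → ℝ) → ℝ) (F : (Z → ℝ) → Prop) (nrm : (Z → ℝ) → ℝ)
    (y : Fin N → Z) (w : Fin N → ℝ) (C : ℝ → ℝ) (α : ℝ) : Prop :=
  ∀ g : Z → ℝ, F g → |I g - ∑ n, w n * g (y n)| ≤ C (nrm g) * (N : ℝ) ^ (-α)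

/-- `C_1 = √(T + (1 + 2 C_f) T² e^{(1 + 2 C_f) T})`. -/
def const1 (T Cf : ℝ) : ℝ := √(T + (1 + 2 * Cf) * T ^ 2 * Real.exp ((1 + 2 * Cf) * T))

/-- `C_{∂D} = |∂D|^{1/2} (‖u‖_{C¹} + ‖v‖_{C¹})`, with `C¹` norms over `∂D × [0,T]` that
involve the full (also the normal) derivative. -/
def constBd {d : ℕ} (D : Set (Pt d)) (T : ℝ) (u v : Pt d × ℝ → ℝ) : ℝ :=
  √((surfaceMeasure D).real Set.univ) *
    (ckNorm 1 (cyl D T) (lateral D T) u + ckNorm 1 (cyl D T) (lateral D T) v)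

/-- `C_2 = √(C_{∂D} T^{1/2})`. -/
def const2 {d : ℕ} (D : Set (Pt d)) (T : ℝ) (u v : Pt d × ℝ → ℝ) : ℝ :=
  √(constBd D T u v * √T)

end HeatPINN

end

open MeasureTheory Set Filter Topology
open scoped NNReal ENNReal Manifold

/-! Put w = u* - u. Then w_t = Δw + R_int + (f(u*) - f(u)), the last term is at most Cf |w| in size,
and w is R_tb at time 0 and R_sb on the lateral boundary. Let Y be the space-time integral of w², A
and B the integrals of R_tb² and R_int², and G = C_∂D √T (∬ R_sb²)^{1/2}. The heart is the stability
bound √Y ≤ C_1 (√A + √B + √G) (`EnergySystem.sqrt_energy_le`). The quadrature hypotheses and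
subadditivity of the square root then turn each integral into a training error plus a quadrature
error.

Stability needs two arguments because of the constant. Gronwall for ‖w(t)‖² doubles the boundary
flux and yields Y ≤ (A + B + 2G) T (e^s - 1)/s with s = (1 + 2 Cf) T. The factor 2 is absorbed by
C_1² when s ≥ 1, hence when Cf T > 1/2, but not for small s, where C_1² behaves like T. For Cf T ≤
1/2 one pairs w(t) with w(t) = w(0) + ∫_0^t w_s ds instead and integrates in t. The boundary term
then carries the factor T only, the dissipation becomes half the square of the time integral of ∇w,
hence nonnegative, and the reaction costs only (Cf T / 2) Y.

The spatial input is Green's formula for two time slices, as an inequality. It needs only |∫_D div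
F| ≤ ∫_∂D |F| ds (`abs_integral_divg_le`), so no normal field and no full area formula. In a
boundary chart a shear flattens the graph and integration by parts gives an integral over ℝ^(d-1).
Its integrand is bounded by the area density times |F|, and a Lipschitz projection bounds that
density by Hausdorff measure (`area_graph_ge`), up to a factor c > 1. A partition of unity
globalizes this without further loss, and c tends to 1. -/

namespace HeatPINN

/-! ### Flattening a graph by a shear -/

section Shear

variable {E : Type*} [NormedAddCommGroup E]

/-- The shear `(x, r) ↦ (x, γ x + r)`. -/
def shear (γ : E → ℝ) (z : E × ℝ) : E × ℝ := (z.1, γ z.1 + z.2)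

theorem continuous_shear {γ : E → ℝ} (hγ : Continuous γ) : Continuous (shear γ) := by
  unfold shear; fun_prop

/-- The shear as a homeomorphism. -/
def shearHomeo {γ : E → ℝ} (hγ : Continuous γ) : (E × ℝ) ≃ₜ (E × ℝ) where
  toFun := shear γ
  invFun z := (z.1, z.2 - γ z.1)
  left_inv z := by simp [shear]
  right_inv z := by simp [shear]
  continuous_toFun := continuous_shear hγ
  continuous_invFun := by fun_prop

end Shear

/-! ### Integration by parts above a graph -/

section HalfGraph

variable {E : Type*} [NormedAddCommGroup E] [InnerProductSpace ℝ E] [FiniteDimensional ℝ E]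
  [MeasurableSpace E] [BorelSpace E]

/-- Integration by parts against the constant function 1; a compactly supported C¹ function is
Lipschitz, which makes this legitimate. -/
theorem integral_fderiv_apply_eq_zero {g : E → ℝ} (hg : ContDiff ℝ 1 g)
    (hc : HasCompactSupport g) (v : E) : ∫ x, fderiv ℝ g x v = 0 := by
  obtain ⟨C, hC⟩ := hg.lipschitzWith_of_hasCompactSupport hc one_ne_zero
  have h := LipschitzWith.integral_lineDeriv_mul_eq (μ := (volume : Measure E))
    (LipschitzWith.const (1 : ℝ)) hC hc (-v)
  have h2 : ∀ x, lineDeriv ℝ g x v = fderiv ℝ g x v := fun x =>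
    ((hg.differentiable one_ne_zero) x).lineDeriv_eq_fderiv
  have h3 : ∀ x w, lineDeriv ℝ (fun _ : E => (1 : ℝ)) x w = 0 := by simp [lineDeriv]
  simpa [h2, h3] using h.symm

theorem measurePreserving_shear {γ : E → ℝ} (hγ : Continuous γ) :
    MeasurePreserving (shear γ) (volume : Measure (E × ℝ)) volume := by
  refine MeasurePreserving.skew_product (f := id) (g := fun x r => γ x + r)
    (MeasurePreserving.id _) ?_ ?_
  · exact Continuous.measurable (by fun_prop)
  · exact Eventually.of_forall fun x => (measurePreserving_add_left volume (γ x)).map_eq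

theorem setIntegral_shear {γ : E → ℝ} (hγ : Continuous γ) (h : E × ℝ → ℝ) :
    ∫ z in {z : E × ℝ | γ z.1 < z.2}, h z = ∫ z in univ ×ˢ Ioi (0 : ℝ), h (shear γ z) := by
  have h1 := (measurePreserving_shear hγ).setIntegral_preimage_emb
    (shearHomeo hγ).measurableEmbedding h {z : E × ℝ | γ z.1 < z.2}
  rw [← h1]
  congr 2
  ext z
  simp [shear]

/-- Integration by parts for a compactly supported function on the region above a graph. -/
theorem integral_fderiv_above_graph {γ : E → ℝ} (hγ : ContDiff ℝ 1 γ) {g : E × ℝ → ℝ}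
    (hg : ContDiffOn ℝ 1 g {z | γ z.1 < z.2}) (hgc : ContinuousOn g {z | γ z.1 ≤ z.2})
    {K : Set (E × ℝ)} (hK : IsCompact K) (hgK : ∀ z, z ∉ K → g z = 0)
    {C : ℝ} (hC : ∀ z, γ z.1 < z.2 → ‖fderiv ℝ g z‖ ≤ C) (v : E × ℝ) :
    ∫ z in {z : E × ℝ | γ z.1 < z.2}, fderiv ℝ g z v =
      ∫ x, (fderiv ℝ γ x v.1 - v.2) * g (x, γ x) := by
  have hγc : Continuous γ := hγ.continuous
  have hγ' : Continuous (fderiv ℝ γ) := hγ.continuous_fderiv one_ne_zero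
  set U : Set (E × ℝ) := {z | γ z.1 < z.2} with hU
  have hUo : IsOpen U := isOpen_lt (by fun_prop) (by fun_prop)
  have hS := continuous_shear hγc
  set W : Set (E × ℝ) := univ ×ˢ Ioi (0 : ℝ) with hW
  have hWo : IsOpen W := isOpen_univ.prod isOpen_Ioi
  have hSW : MapsTo (shear γ) W U := by
    intro z hz; simpa [shear, hU, hW] using hz
  set K' : Set (E × ℝ) := shear γ ⁻¹' K with hK'
  have hK'c : IsCompact K' := (shearHomeo hγc).isCompact_preimage.2 hK
  have hD0 : ∀ z, z ∉ K → fderiv ℝ g z = 0 := by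
    intro z hz
    have : g =ᶠ[𝓝 z] fun _ => 0 := by
      filter_upwards [hK.isClosed.isOpen_compl.mem_nhds hz] with y hy using hgK y hy
    rw [this.fderiv_eq]; simp
  have hdiff : ∀ z ∈ U, DifferentiableAt ℝ g z := fun z hz =>
    (hg.differentiableOn one_ne_zero).differentiableAt (hUo.mem_nhds hz)
  have hDc : ContinuousOn (fderiv ℝ g) U := hg.continuousOn_fderiv_of_isOpen hUo le_rfl
  have key : ∀ c : E → E × ℝ, Continuous c →
      IntegrableOn (fun z => fderiv ℝ g (shear γ z) (c z.1)) W := by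
    intro c hc
    have hcont : ContinuousOn (fun z : E × ℝ => fderiv ℝ g (shear γ z) (c z.1)) W :=
      (hDc.comp hS.continuousOn hSW).clm_apply (by fun_prop)
    have hb : IntegrableOn (fun z : E × ℝ => C * ‖c z.1‖) K' :=
      (by fun_prop : Continuous fun z : E × ℝ => C * ‖c z.1‖).continuousOn.integrableOn_compact hK'c
    have h1 : IntegrableOn (fun z => fderiv ℝ g (shear γ z) (c z.1)) (W ∩ K') := by
      refine Integrable.mono' (hb.mono_set inter_subset_right)
        ((hcont.mono inter_subset_left).aestronglyMeasurable
          (hWo.measurableSet.inter hK'c.measurableSet)) ?_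
      refine (ae_restrict_mem (hWo.measurableSet.inter hK'c.measurableSet)).mono ?_
      intro z hz
      exact (ContinuousLinearMap.le_opNorm _ _).trans
        (mul_le_mul_of_nonneg_right (hC _ (hSW hz.1)) (norm_nonneg _))
    refine h1.of_forall_sdiff_eq_zero hWo.measurableSet ?_
    intro z hz
    have : shear γ z ∉ K := fun h => hz.2 ⟨hz.1, h⟩
    simp [hD0 _ this]
  -- The direction `v` splits into a part tangent to the translated graphs and a vertical part;
  -- these correspond to the x- and r-derivatives of `g` composed with the shear.
  have hsplit : ∀ z : E × ℝ, fderiv ℝ g (shear γ z) v =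
      fderiv ℝ g (shear γ z) (v.1, fderiv ℝ γ z.1 v.1)
        + fderiv ℝ g (shear γ z) (0, v.2 - fderiv ℝ γ z.1 v.1) := by
    intro z
    rw [← map_add]; congr 1; ext <;> simp
  rw [setIntegral_shear hγc, setIntegral_congr_fun hWo.measurableSet (fun z _ => hsplit z)]
  have hcA : Continuous fun x => (v.1, fderiv ℝ γ x v.1) := by fun_prop
  have hcB : Continuous fun x => ((0 : E), v.2 - fderiv ℝ γ x v.1) := by fun_prop
  have iA := key _ hcA
  have iB := key _ hcB
  rw [integral_add iA iB]
  -- For fixed r > 0 the tangential part is the derivative of the compactly supported function x ↦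
  -- g(x, γ x + r), so it integrates to zero.
  have hA : ∫ z in W, fderiv ℝ g (shear γ z) (v.1, fderiv ℝ γ z.1 v.1) = 0 := by
    rw [hW, Measure.volume_eq_prod, ← Measure.prod_restrict, integral_prod_symm]
    · refine setIntegral_eq_zero_of_forall_eq_zero ?_
      intro r hr
      rw [Measure.restrict_univ]
      have hcomp : ContDiff ℝ 1 fun x => g (shear γ (x, r)) := by
        rw [← contDiffOn_univ]
        refine hg.comp (t := U) ?_ ?_
        · exact (contDiff_id.prodMk (hγ.add contDiff_const)).contDiffOn
        · intro x _; exact hSW ⟨mem_univ _, hr⟩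
      have hsupp : HasCompactSupport fun x => g (shear γ (x, r)) := by
        refine HasCompactSupport.intro (hK'c.image continuous_fst) ?_
        intro x hx
        apply hgK
        intro h
        exact hx ⟨(x, r), h, rfl⟩
      rw [← integral_fderiv_apply_eq_zero hcomp hsupp v.1]
      congr 1
      ext x
      have hx : HasFDerivAt (fun x => shear γ (x, r))
          ((ContinuousLinearMap.id ℝ E).prod (fderiv ℝ γ x)) x :=
        (hasFDerivAt_id x).prodMk
          (((hγ.differentiable one_ne_zero) x).hasFDerivAt.add_const r)
      have h2 := (hdiff (shear γ (x, r)) (hSW ⟨mem_univ _, hr⟩)).hasFDerivAt.comp x hx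
      have h3 : fderiv ℝ (fun x => g (shear γ (x, r))) x = _ := h2.fderiv
      rw [h3]; rfl
    · rw [Measure.prod_restrict]; exact iA
  -- The vertical part is integrated exactly in r from 0 to ∞ and leaves only the trace of `g` on
  -- the graph.
  have hB : ∫ z in W, fderiv ℝ g (shear γ z) (0, v.2 - fderiv ℝ γ z.1 v.1)
      = ∫ x, (fderiv ℝ γ x v.1 - v.2) * g (x, γ x) := by
    have i1 : IntegrableOn (fun z : E × ℝ => fderiv ℝ g (shear γ z) ((0 : E), (1 : ℝ))) W :=
      key (fun _ => (0, 1)) continuous_const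
    have i1' : ∀ᵐ x : E, IntegrableOn
        (fun r => fderiv ℝ g (shear γ (x, r)) ((0 : E), (1 : ℝ))) (Ioi (0 : ℝ)) := by
      rw [hW, IntegrableOn, Measure.volume_eq_prod, ← Measure.prod_restrict,
        Measure.restrict_univ] at i1
      exact i1.prod_right_ae
    rw [hW, Measure.volume_eq_prod, setIntegral_prod _ (by exact iB), Measure.restrict_univ]
    refine integral_congr_ae ?_
    filter_upwards [i1'] with x hx
    have hlin : ∀ r, fderiv ℝ g (shear γ (x, r)) (0, v.2 - fderiv ℝ γ x v.1)
        = (v.2 - fderiv ℝ γ x v.1) * fderiv ℝ g (shear γ (x, r)) (0, 1) := by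
      intro r
      rw [← smul_eq_mul, ← map_smul]; simp
    simp_rw [hlin]
    rw [integral_const_mul]
    have hder : ∀ r ∈ Ioi (0 : ℝ), HasDerivAt (fun r => g (shear γ (x, r)))
        (fderiv ℝ g (shear γ (x, r)) (0, 1)) r := by
      intro r hr
      have h1 : HasDerivAt (fun r => shear γ (x, r)) ((0 : E), (1 : ℝ)) r := by
        simp only [shear]
        exact (hasDerivAt_const r x).prodMk ((hasDerivAt_id r).const_add (γ x))
      exact (hdiff _ (hSW ⟨mem_univ _, hr⟩)).hasFDerivAt.comp_hasDerivAt r h1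
    have hlim : Tendsto (fun r => g (shear γ (x, r))) atTop (𝓝 0) := by
      obtain ⟨R, hR⟩ := (hK'c.image continuous_snd).isBounded.subset_closedBall 0
      refine tendsto_const_nhds.congr' ?_
      filter_upwards [eventually_gt_atTop R] with r hr
      symm
      apply hgK
      intro h
      have := hR ⟨(x, r), h, rfl⟩
      rw [mem_closedBall_zero_iff] at this
      exact absurd ((le_abs_self r).trans this) (not_le.2 hr)
    have hcw : ContinuousWithinAt (fun r => g (shear γ (x, r))) (Ici 0) 0 := by
      refine (hgc.comp (s := Ici (0 : ℝ)) (f := fun r => shear γ (x, r)) ?_ ?_) 0 self_mem_Ici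
      · exact (hS.comp (by fun_prop : Continuous fun r : ℝ => (x, r))).continuousOn
      · intro r hr; simpa [shear] using hr
    rw [integral_Ioi_of_hasDerivAt_of_tendsto hcw hder hx hlim]
    simp only [shear, add_zero]
    ring
  rw [hA, hB, zero_add]

end HalfGraph

/-! ### Lower bound for the Hausdorff measure of a graph -/

section Area

theorem euclideanHausdorffMeasure_image_le {X Y : Type*} [EMetricSpace X] [EMetricSpace Y]
    [MeasurableSpace X] [BorelSpace X] [MeasurableSpace Y] [BorelSpace Y] {K : ℝ≥0} {f : X → Y}
    {s : Set X} (hf : LipschitzOnWith K f s) (n : ℕ) :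
    Measure.euclideanHausdorffMeasure n (f '' s)
      ≤ (K : ℝ≥0∞) ^ n * Measure.euclideanHausdorffMeasure n s := by
  simp only [Measure.euclideanHausdorffMeasure_def, Measure.smul_apply, ENNReal.smul_def,
    smul_eq_mul]
  have h := hf.hausdorffMeasure_image_le (d := (n : ℝ)) (Nat.cast_nonneg n)
  rw [ENNReal.rpow_natCast] at h
  calc _ ≤ _ * ((K : ℝ≥0∞) ^ n * μH[n] s) := by gcongr
    _ = _ := by ring

/-- The linear map `(1 + a ⊗ a)^{1/2}`, for which `‖A v‖² = ‖v‖² + ⟪a, v⟫²`. -/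
noncomputable def graphStretch {n : ℕ} (a : Pt n) : Pt n →ₗ[ℝ] Pt n :=
  LinearMap.transvection (innerₛₗ ℝ a) ((1 + √(1 + ‖a‖ ^ 2))⁻¹ • a)

theorem det_graphStretch {n : ℕ} (a : Pt n) :
    LinearMap.det (graphStretch a) = √(1 + ‖a‖ ^ 2) := by
  have h : (0 : ℝ) ≤ 1 + ‖a‖ ^ 2 := by positivity
  have h2 := Real.sq_sqrt h
  have h3 : 0 < 1 + √(1 + ‖a‖ ^ 2) := by positivity
  rw [graphStretch, LinearMap.transvection.det]
  simp only [map_smul, innerₛₗ_apply_apply, real_inner_self_eq_norm_sq, smul_eq_mul]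
  field_simp
  nlinarith

theorem norm_graphStretch_sq {n : ℕ} (a v : Pt n) :
    ‖graphStretch a v‖ ^ 2 = ‖v‖ ^ 2 + (inner ℝ a v) ^ 2 := by
  have h : (0 : ℝ) ≤ 1 + ‖a‖ ^ 2 := by positivity
  have h2 := Real.sq_sqrt h
  have h3 : 0 < 1 + √(1 + ‖a‖ ^ 2) := by positivity
  have h4 : graphStretch a v = v + (inner ℝ a v * (1 + √(1 + ‖a‖ ^ 2))⁻¹) • a := by
    simp [graphStretch, LinearMap.transvection.apply, smul_smul]
  rw [h4, norm_add_sq_real, norm_smul, inner_smul_right, real_inner_comm, mul_pow,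
    Real.norm_eq_abs, sq_abs]
  field_simp
  have h5 : ‖a‖ ^ 2 = √(1 + ‖a‖ ^ 2) ^ 2 - 1 := by linarith
  nlinarith

/-- The parametrization of the graph of `γ` in the coordinates given by `e`. -/
noncomputable def graphPt {d n : ℕ} (e : Pt d ≃ₗᵢ[ℝ] WithLp 2 (Pt n × ℝ)) (γ : Pt n → ℝ) (x : Pt n) : Pt d :=
  e.symm (WithLp.toLp 2 (x, γ x))

theorem contDiff_graphPt {d n : ℕ} (e : Pt d ≃ₗᵢ[ℝ] WithLp 2 (Pt n × ℝ)) {γ : Pt n → ℝ}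
    (hγ : ContDiff ℝ 1 γ) : ContDiff ℝ 1 (graphPt e γ) := by
  unfold graphPt
  refine e.symm.contDiff.comp ?_
  exact (WithLp.prodContinuousLinearEquiv 2 ℝ (Pt n) ℝ).symm.contDiff.comp
    (contDiff_id.prodMk hγ)

/-- The projection of the graph to ℝ^n followed by `graphStretch a` maps it onto the stretched copy
of `S`, whose volume is √(1 + ‖a‖²) times that of `S`. It is (1 + ε)-Lipschitz: the stretched length
of x - y is the length of the chord of the linear graph, which differs from the true chord by at
most ε ‖x - y‖. Lipschitz maps enlarge n-dimensional Hausdorff measure by at most the n-th power of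
the constant. -/
theorem area_graph_ge {d n : ℕ} (e : Pt d ≃ₗᵢ[ℝ] WithLp 2 (Pt n × ℝ)) {γ : Pt n → ℝ} {a : Pt n}
    {S : Set (Pt n)} {ε : ℝ≥0} (hS : ApproximatesLinearOn γ (innerSL ℝ a) S ε) :
    ENNReal.ofReal √(1 + ‖a‖ ^ 2) * volume S ≤
      ((1 + ε : ℝ≥0) : ℝ≥0∞) ^ n *
        (Measure.euclideanHausdorffMeasure n : Measure (Pt d)) (graphPt e γ '' S) := by
  have h1 := Measure.addHaar_image_linearMap volume (graphStretch a) S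
  rw [det_graphStretch, abs_of_nonneg (Real.sqrt_nonneg _)] at h1
  rw [← h1, ← EuclideanSpace.euclideanHausdorffMeasure_eq_volume]
  have h2 : LipschitzOnWith (1 + ε) (fun z : Pt d => graphStretch a (e z).fst)
      (graphPt e γ '' S) := by
    refine LipschitzOnWith.of_dist_le_mul ?_
    rintro _ ⟨x, hx, rfl⟩ _ ⟨y, hy, rfl⟩
    simp only [graphPt, LinearIsometryEquiv.apply_symm_apply, LinearIsometryEquiv.dist_map]
    rw [dist_eq_norm, dist_eq_norm, ← map_sub]
    set p : WithLp 2 (Pt n × ℝ) := WithLp.toLp 2 (x, γ x) - WithLp.toLp 2 (y, γ y) with hp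
    have hpf : p.fst = x - y := rfl
    have hps : p.snd = γ x - γ y := rfl
    set q : WithLp 2 (Pt n × ℝ) := WithLp.toLp 2 (x - y, inner ℝ a (x - y)) with hq
    have hA : ‖graphStretch a (x - y)‖ = ‖q‖ := by
      rw [← sq_eq_sq₀ (norm_nonneg _) (norm_nonneg _), norm_graphStretch_sq,
        WithLp.prod_norm_sq_eq_of_L2]
      simp [hq]
    have hqp : ‖q - p‖ = ‖γ x - γ y - inner ℝ a (x - y)‖ := by
      rw [← sq_eq_sq₀ (norm_nonneg _) (norm_nonneg _), WithLp.prod_norm_sq_eq_of_L2]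
      change ‖(x - y) - (x - y)‖ ^ 2 + ‖inner ℝ a (x - y) - (γ x - γ y)‖ ^ 2 = _
      rw [sub_self, norm_zero, norm_sub_rev]
      ring
    have h3 : ‖γ x - γ y - inner ℝ a (x - y)‖ ≤ ε * ‖x - y‖ := by
      simpa using hS x hx y hy
    have h4 : ‖x - y‖ ≤ ‖p‖ := by
      rw [← hpf]; exact WithLp.norm_fst_le _ _
    change ‖graphStretch a (x - y)‖ ≤ ((1 + ε : ℝ≥0) : ℝ) * ‖p‖
    rw [hA]
    calc ‖q‖ = ‖p + (q - p)‖ := by congr 1; abel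
      _ ≤ ‖p‖ + ‖q - p‖ := norm_add_le _ _
      _ ≤ ‖p‖ + ε * ‖p‖ := by
        rw [hqp]; gcongr; exact h3.trans (by gcongr)
      _ = _ := by push_cast; ring
  have h3 := euclideanHausdorffMeasure_image_le h2 n
  have h4 : (fun z : Pt d => graphStretch a (e z).fst) '' (graphPt e γ '' S)
      = graphStretch a '' S := by
    rw [image_image]
    simp [graphPt]
  rwa [h4] at h3

end Area

/-! ### Geometry of the boundary in a chart -/

section Chart

variable {d n : ℕ} {D : Set (Pt d)} {x : Pt d} {r : ℝ}
  {e : Pt d ≃ₗᵢ[ℝ] WithLp 2 (Pt n × ℝ)} {γ : Pt n → ℝ}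

theorem mem_frontier_iff_of_chart (hDo : IsOpen D) (hγ : Continuous γ)
    (hloc : ∀ y ∈ Metric.ball x r, (y ∈ D ↔ γ (e y).fst < (e y).snd)) {y : Pt d}
    (hy : y ∈ Metric.ball x r) : y ∈ frontier D ↔ γ (e y).fst = (e y).snd := by
  have hball : Metric.ball x r ∈ 𝓝 y := Metric.isOpen_ball.mem_nhds hy
  have hcf : Continuous fun z : Pt d => (e z).fst :=
    (WithLp.continuous_fst _ _ _).comp e.continuous
  have hcs : Continuous fun z : Pt d => (e z).snd :=
    (WithLp.continuous_snd _ _ _).comp e.continuous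
  rw [hDo.frontier_eq]
  constructor
  · rintro ⟨h1, h2⟩
    rw [hloc y hy, not_lt] at h2
    refine le_antisymm (not_lt.1 fun h3 => ?_) h2
    have h4 : {z : Pt d | (e z).snd < γ (e z).fst} ∈ 𝓝 y :=
      (isOpen_lt hcs (hγ.comp hcf)).mem_nhds h3
    obtain ⟨z, ⟨hz1, hz2⟩, hz3⟩ := mem_closure_iff_nhds.1 h1 _ (inter_mem hball h4)
    exact absurd ((hloc z hz1).1 hz3) (not_lt.2 hz2.le)
  · intro h
    refine ⟨?_, fun h1 => absurd ((hloc y hy).1 h1) (not_lt.2 h.ge)⟩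
    -- Moving a graph point upwards along the last coordinate enters `D` at once, so the point lies
    -- in the closure.
    have hc : Continuous fun t : ℝ => y + t • e.symm (WithLp.toLp 2 (0, 1)) := by fun_prop
    have hlim : Tendsto (fun t : ℝ => y + t • e.symm (WithLp.toLp 2 (0, 1))) (𝓝[>] 0) (𝓝 y) := by
      have := hc.tendsto 0
      simp only [zero_smul, add_zero] at this
      exact this.mono_left nhdsWithin_le_nhds
    refine mem_closure_of_tendsto hlim ?_
    filter_upwards [hlim hball, self_mem_nhdsWithin] with t ht1 ht2
    rw [hloc _ ht1]
    have h1 : (e (y + t • e.symm (WithLp.toLp 2 (0, 1)))).fst = (e y).fst := by simp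
    have h2 : (e (y + t • e.symm (WithLp.toLp 2 (0, 1)))).snd = (e y).snd + t := by simp
    rw [h1, h2, h]
    exact lt_add_of_pos_right _ ht2

theorem graphPt_fst_of_eq {y : Pt d} (h : γ (e y).fst = (e y).snd) : graphPt e γ (e y).fst = y := by
  rw [graphPt, h]
  exact e.symm_apply_apply y

theorem dist_fst_le (e : Pt d ≃ₗᵢ[ℝ] WithLp 2 (Pt n × ℝ)) (y z : Pt d) :
    dist (e y).fst (e z).fst ≤ dist y z :=
  (WithLp.dist_fst_le (e y) (e z)).trans_eq (e.dist_map y z)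

/-- The surface measure of the boundary is finite near each boundary point. -/
theorem finiteAt_frontier_of_chart (hDo : IsOpen D) (hγ : ContDiff ℝ 1 γ)
    (hloc : ∀ y ∈ Metric.ball x r, (y ∈ D ↔ γ (e y).fst < (e y).snd)) (hr : 0 < r) :
    (Measure.euclideanHausdorffMeasure n : Measure (Pt d)).FiniteAtFilter
      (𝓝[frontier D] x) := by
  obtain ⟨K, t, ht, hK⟩ := (((contDiff_graphPt e hγ).contDiffAt
    (x := (e x).fst)).hasStrictFDerivAt one_ne_zero).exists_lipschitzOnWith
  obtain ⟨δ, hδ, hδt⟩ := Metric.mem_nhds_iff.1 ht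
  refine ⟨frontier D ∩ Metric.ball x (min r δ), inter_mem self_mem_nhdsWithin
    (mem_nhdsWithin_of_mem_nhds (Metric.ball_mem_nhds _ (lt_min hr hδ))), ?_⟩
  have hsub : frontier D ∩ Metric.ball x (min r δ) ⊆
      graphPt e γ '' Metric.ball (e x).fst δ := by
    rintro y ⟨hy1, hy2⟩
    have hyr : y ∈ Metric.ball x r := Metric.ball_subset_ball (min_le_left _ _) hy2
    have h := (mem_frontier_iff_of_chart hDo hγ.continuous hloc hyr).1 hy1
    refine ⟨(e y).fst, ?_, graphPt_fst_of_eq h⟩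
    exact (dist_fst_le e y x).trans_lt (lt_of_lt_of_le hy2 (min_le_right _ _))
  refine (measure_mono hsub).trans_lt ?_
  refine (euclideanHausdorffMeasure_image_le (hK.mono hδt) n).trans_lt ?_
  rw [EuclideanSpace.euclideanHausdorffMeasure_eq_volume]
  exact ENNReal.mul_lt_top (by simp) measure_ball_lt_top

/-- Near `x` the function `γ` is `K`-Lipschitz, so `D` contains the tip at `x` of the open cone of
slope `K`. This tip is open, convex and has `x` in its closure. -/
theorem uniqueDiffWithinAt_of_chart (hγ : ContDiff ℝ 1 γ)
    (hloc : ∀ y ∈ Metric.ball x r, (y ∈ D ↔ γ (e y).fst < (e y).snd)) (hr : 0 < r)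
    (hx : γ (e x).fst = (e x).snd) : UniqueDiffWithinAt ℝ D x := by
  obtain ⟨K, t, ht, hK⟩ := ((hγ.contDiffAt (x := (e x).fst)).hasStrictFDerivAt
    one_ne_zero).exists_lipschitzOnWith
  obtain ⟨δ, hδ, hδt⟩ := Metric.mem_nhds_iff.1 ht
  have hcf : Continuous fun z : Pt d => (e z).fst :=
    (WithLp.continuous_fst _ _ _).comp e.continuous
  have hcs : Continuous fun z : Pt d => (e z).snd :=
    (WithLp.continuous_snd _ _ _).comp e.continuous
  set C : Set (Pt d) := Metric.ball x (min r δ) ∩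
    {y | (K : ℝ) * ‖(e (y - x)).fst‖ < (e (y - x)).snd} with hC
  have hcont : Continuous fun y : Pt d => (K : ℝ) * ‖(e (y - x)).fst‖ :=
    continuous_const.mul (hcf.comp (continuous_sub_right x)).norm
  have hcont2 : Continuous fun y : Pt d => (e (y - x)).snd := hcs.comp (continuous_sub_right x)
  have hCo : IsOpen C := Metric.isOpen_ball.inter (isOpen_lt hcont hcont2)
  have hCconv : Convex ℝ C := by
    refine (convex_ball _ _).inter ?_
    intro y hy z hz a b ha hb hab
    simp only [mem_ofPred_eq] at hy hz ⊢
    have h1 : a • y + b • z - x = a • (y - x) + b • (z - x) := by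
      have : x = a • x + b • x := by rw [← add_smul, hab, one_smul]
      nth_rewrite 1 [this]
      module
    rw [h1, map_add, map_smul, map_smul]
    simp only [WithLp.add_fst, WithLp.add_snd, WithLp.smul_fst, WithLp.smul_snd, smul_eq_mul]
    have h2 : ‖a • (e (y - x)).fst + b • (e (z - x)).fst‖
        ≤ a * ‖(e (y - x)).fst‖ + b * ‖(e (z - x)).fst‖ := by
      refine (norm_add_le _ _).trans ?_
      rw [norm_smul, norm_smul, Real.norm_of_nonneg ha, Real.norm_of_nonneg hb]
    have h3 := mul_le_mul_of_nonneg_left h2 K.coe_nonneg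
    -- For a = 0 the strict inequality at `y` is lost on multiplication, and the one at `z` must
    -- serve alone.
    rcases ha.eq_or_lt with rfl | ha'
    · have : b = 1 := by linarith
      subst this
      linarith
    · nlinarith
  have hCD : C ⊆ D := by
    rintro y ⟨hy1, hy2⟩
    have hyr : y ∈ Metric.ball x r := Metric.ball_subset_ball (min_le_left _ _) hy1
    have hyδ : dist y x < δ := lt_of_lt_of_le hy1 (min_le_right _ _)
    rw [hloc y hyr]
    have h1 := hK.dist_le_mul (e y).fst (hδt ((dist_fst_le e y x).trans_lt hyδ))
      (e x).fst (hδt (Metric.mem_ball_self hδ))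
    rw [Real.dist_eq, dist_eq_norm] at h1
    have h2 := (abs_le.1 h1).2
    simp only [mem_ofPred_eq, map_sub, WithLp.sub_fst, WithLp.sub_snd] at hy2
    linarith
  have hlim : Tendsto (fun t : ℝ => x + t • e.symm (WithLp.toLp 2 (0, 1))) (𝓝[>] 0) (𝓝 x) := by
    have hc : Continuous fun t : ℝ => x + t • e.symm (WithLp.toLp 2 (0, 1)) := by fun_prop
    have := hc.tendsto 0
    simp only [zero_smul, add_zero] at this
    exact this.mono_left nhdsWithin_le_nhds
  have hev : ∀ᶠ t : ℝ in 𝓝[>] 0, x + t • e.symm (WithLp.toLp 2 (0, 1)) ∈ C := by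
    filter_upwards [hlim (Metric.ball_mem_nhds x (lt_min hr hδ)), self_mem_nhdsWithin]
      with t ht1 ht2
    refine ⟨ht1, ?_⟩
    simpa using ht2
  refine (uniqueDiffWithinAt_convex hCconv ?_ (mem_closure_of_tendsto hlim hev)).mono hCD
  rw [hCo.interior_eq]
  exact hev.exists.elim fun t ht => ⟨_, ht⟩

end Chart

/-! ### Flux density and surface measure in a chart -/

section ChartMeasure

variable {d n : ℕ} {D : Set (Pt d)} {x : Pt d} {r : ℝ}
  {e : Pt d ≃ₗᵢ[ℝ] WithLp 2 (Pt n × ℝ)} {γ : Pt n → ℝ}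

/-- Cauchy–Schwarz in ℝ^n × ℝ against the vector (a, -1), which is normal to the graph of slope `a`.
-/
theorem abs_inner_sub_le {n : ℕ} (a p : Pt n) (s : ℝ) :
    |inner ℝ a p - s| ≤ √(1 + ‖a‖ ^ 2) * √(‖p‖ ^ 2 + s ^ 2) := by
  rw [← Real.sqrt_mul (by positivity)]
  refine Real.le_sqrt_of_sq_le ?_
  rw [sq_abs]
  have h1 := abs_real_inner_le_norm a p
  have h2 : (inner ℝ a p - s) ^ 2 ≤ (‖a‖ * ‖p‖ + |s|) ^ 2 := by
    refine sq_le_sq' ?_ ?_ <;> linarith [abs_le.1 h1, abs_le.1 (le_refl |s|)]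
  nlinarith [sq_nonneg (‖a‖ * |s| - ‖p‖), sq_abs s]

/-- The left side is the flux of `p` through the graph per unit of parameter volume. The error of
size ε ‖p‖ in the slope is absorbed because √(1 + ‖a‖²) ≥ 1. -/
theorem abs_fderiv_sub_le {n : ℕ} {a : Pt n} {ε : ℝ} {L : Pt n →L[ℝ] ℝ}
    (hL : ‖L - innerSL ℝ a‖ ≤ ε) (p : WithLp 2 (Pt n × ℝ)) :
    |L p.fst - p.snd| ≤ (1 + ε) * √(1 + ‖a‖ ^ 2) * ‖p‖ := by
  have h0 : 0 ≤ ε := (norm_nonneg _).trans hL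
  have h1 := abs_inner_sub_le a p.fst p.snd
  have hp : √(‖p.fst‖ ^ 2 + p.snd ^ 2) = ‖p‖ := by
    rw [← Real.sqrt_sq (norm_nonneg p), WithLp.prod_norm_sq_eq_of_L2]; simp
  rw [hp] at h1
  have h2 : |(L - innerSL ℝ a) p.fst| ≤ ε * ‖p‖ :=
    ((L - innerSL ℝ a).le_opNorm p.fst).trans
      (mul_le_mul hL (WithLp.norm_fst_le _ p) (norm_nonneg _) h0)
  have h3 : L p.fst - p.snd = (inner ℝ a p.fst - p.snd) + (L - innerSL ℝ a) p.fst := by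
    simp
  have h4 : (1 : ℝ) ≤ √(1 + ‖a‖ ^ 2) := Real.one_le_sqrt.2 (by nlinarith [sq_nonneg ‖a‖])
  rw [h3]
  refine (abs_add_le _ _).trans ?_
  have h5 : 0 ≤ ε * ‖p‖ := by positivity
  nlinarith

/-- This puts `area_graph_ge` in the form of an inequality of measures, against which nonnegative
functions such as ‖F‖ can be integrated. -/
theorem map_graphPt_le (hDo : IsOpen D) (hγ : ContDiff ℝ 1 γ)
    (hloc : ∀ y ∈ Metric.ball x r, (y ∈ D ↔ γ (e y).fst < (e y).snd)) {ρ δ : ℝ} (hρr : ρ ≤ r)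
    (hρδ : ρ ≤ δ) {a : Pt n} {ε : ℝ≥0}
    (hS : ApproximatesLinearOn γ (innerSL ℝ a) (Metric.ball (e x).fst δ) ε) :
    ENNReal.ofReal √(1 + ‖a‖ ^ 2) •
        (volume.restrict (graphPt e γ ⁻¹' Metric.ball x ρ)).map (graphPt e γ) ≤
      ((1 + ε : ℝ≥0) : ℝ≥0∞) ^ n •
        (Measure.euclideanHausdorffMeasure n : Measure (Pt d)).restrict (frontier D) := by
  have hΓ : Continuous (graphPt e γ) := (contDiff_graphPt e hγ).continuous
  refine Measure.le_iff.2 fun S hSm => ?_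
  rw [Measure.smul_apply, Measure.smul_apply, Measure.map_apply hΓ.measurable hSm,
    Measure.restrict_apply (hΓ.measurable hSm), Measure.restrict_apply hSm, smul_eq_mul,
    smul_eq_mul]
  set V := graphPt e γ ⁻¹' S ∩ graphPt e γ ⁻¹' Metric.ball x ρ
  have hV : V ⊆ Metric.ball (e x).fst δ := by
    rintro y ⟨-, hy⟩
    have h1 := (dist_fst_le e (graphPt e γ y) x).trans_lt (lt_of_lt_of_le hy hρδ)
    simpa [graphPt] using h1
  refine (area_graph_ge e (hS.mono_set hV)).trans ?_
  gcongr
  rintro _ ⟨y, ⟨hy1, hy2⟩, rfl⟩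
  refine ⟨hy1, ?_⟩
  rw [mem_frontier_iff_of_chart hDo hγ.continuous hloc (Metric.ball_subset_ball hρr hy2)]
  simp [graphPt]

end ChartMeasure

/-! ### The divergence integral in graph coordinates -/

section Divergence

/-- The divergence of a vector field on `ℝ^d`. -/
noncomputable def divg {d : ℕ} (F : Pt d → Pt d) (x : Pt d) : ℝ :=
  ∑ i, fderiv ℝ F x (EuclideanSpace.single i 1) i

theorem integrableOn_of_bounded_of_compact {X : Type*} [TopologicalSpace X] [T2Space X]
    [SecondCountableTopology X] [MeasurableSpace X] [BorelSpace X] {μ : Measure X}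
    [IsFiniteMeasureOnCompacts μ]
    {U K : Set X} {h : X → ℝ} (hU : MeasurableSet U) (hh : ContinuousOn h U) {C : ℝ}
    (hC : ∀ z ∈ U, |h z| ≤ C) (hK : IsCompact K) (h0 : ∀ z ∈ U, z ∉ K → h z = 0) :
    IntegrableOn h U μ := by
  have h1 : IntegrableOn h (U ∩ K) μ := by
    refine IntegrableOn.of_bound ?_ ?_ C ?_
    · exact (measure_mono inter_subset_right).trans_lt hK.measure_lt_top
    · exact (hh.mono inter_subset_left).aestronglyMeasurable (hU.inter hK.measurableSet)
    · exact (ae_restrict_mem (hU.inter hK.measurableSet)).mono fun z hz => hC z hz.1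
  exact h1.of_forall_sdiff_eq_zero hU fun z hz => h0 z hz.1 fun h => hz.2 ⟨hz.1, h⟩

variable {d n : ℕ} {D : Set (Pt d)}

theorem divg_eq_zero_of_notMem {F : Pt d → Pt d} {K : Set (Pt d)} (hK : IsCompact K)
    (h0 : ∀ z, z ∉ K → F z = 0) {z : Pt d} (hz : z ∉ K) : divg F z = 0 := by
  have : F =ᶠ[𝓝 z] fun _ => 0 := by
    filter_upwards [hK.isClosed.isOpen_compl.mem_nhds hz] with y hy using h0 y hy
  simp [divg, this.fderiv_eq]

/-- The divergence of a field supported near a boundary point, in graph coordinates. -/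
theorem integral_divg_eq_of_chart {x : Pt d} {r : ℝ}
    {e : Pt d ≃ₗᵢ[ℝ] WithLp 2 (Pt n × ℝ)} {γ : Pt n → ℝ} (hDo : IsOpen D) (hγ : ContDiff ℝ 1 γ)
    (hloc : ∀ y ∈ Metric.ball x r, (y ∈ D ↔ γ (e y).fst < (e y).snd))
    {F : Pt d → Pt d} (hF : ContDiffOn ℝ 1 F D) (hFc : ContinuousOn F (closure D)) {C : ℝ}
    (hC : ∀ z ∈ D, ‖fderiv ℝ F z‖ ≤ C) {K : Set (Pt d)} (hK : IsCompact K)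
    (hKr : K ⊆ Metric.ball x r) (h0 : ∀ z, z ∉ K → F z = 0) :
    ∫ z in D, divg F z =
      ∫ p, (fderiv ℝ γ p (e (F (graphPt e γ p))).fst - (e (F (graphPt e γ p))).snd) := by
  set Φ : Pt d ≃L[ℝ] Pt n × ℝ :=
    e.toContinuousLinearEquiv.trans (WithLp.prodContinuousLinearEquiv 2 ℝ (Pt n) ℝ) with hΦ
  have hΦ1 : ∀ y, (Φ y).1 = (e y).fst := fun y => rfl
  have hΦ2 : ∀ y, (Φ y).2 = (e y).snd := fun y => rfl
  have hΦg : ∀ p, Φ.symm (p, γ p) = graphPt e γ p := fun p => rfl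
  have hΦm : MeasurePreserving Φ volume volume :=
    (WithLp.volume_preserving_ofLp (Pt n) ℝ).comp e.measurePreserving
  set U : Set (Pt n × ℝ) := {z | γ z.1 < z.2} with hU
  have hUo : IsOpen U := isOpen_lt (by fun_prop) (by fun_prop)
  set Ω : Set (Pt d) := Φ ⁻¹' U with hΩ
  have hΩo : IsOpen Ω := hUo.preimage Φ.continuous
  have hDΩ : ∀ y ∈ Metric.ball x r, (y ∈ D ↔ y ∈ Ω) := fun y hy => hloc y hy
  have hF0 : ∀ z, z ∉ K → F =ᶠ[𝓝 z] fun _ => 0 := by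
    intro z hz
    filter_upwards [hK.isClosed.isOpen_compl.mem_nhds hz] with y hy using h0 y hy
  -- regularity on the region above the graph
  have hFΩ : ∀ y ∈ Ω, ContDiffAt ℝ 1 F y := by
    intro y hy
    by_cases hyK : y ∈ K
    · have hyD : y ∈ D := (hDΩ y (hKr hyK)).2 hy
      exact (hF y hyD).contDiffAt (hDo.mem_nhds hyD)
    · exact contDiffAt_const.congr_of_eventuallyEq (hF0 y hyK)
  have hCΩ : ∀ y ∈ Ω, ‖fderiv ℝ F y‖ ≤ max C 0 := by
    intro y hy
    by_cases hyK : y ∈ K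
    · exact (hC y ((hDΩ y (hKr hyK)).2 hy)).trans (le_max_left _ _)
    · rw [(hF0 y hyK).fderiv_eq]; simp
  have hFcl : ContinuousOn F (Φ ⁻¹' {z | γ z.1 ≤ z.2}) := by
    intro y hy
    by_cases hyK : y ∈ K
    · have hb := hKr hyK
      have hball : Metric.ball x r ∈ 𝓝 y := Metric.isOpen_ball.mem_nhds hb
      have hmem : ∀ z ∈ Metric.ball x r, γ (e z).fst ≤ (e z).snd → z ∈ closure D := by
        intro z hz hz2
        rcases hz2.lt_or_eq with h | h
        · exact subset_closure ((hloc z hz).2 h)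
        · exact frontier_subset_closure
            ((mem_frontier_iff_of_chart hDo hγ.continuous hloc hz).2 h)
      refine (hFc y (hmem y hb hy)).mono_of_mem_nhdsWithin ?_
      filter_upwards [mem_nhdsWithin_of_mem_nhds hball, self_mem_nhdsWithin] with z hz1 hz2
        using hmem z hz1 hz2
    · exact (continuousAt_const.congr (hF0 y hyK).symm).continuousWithinAt
  -- passage to the coordinates
  have hstep1 : ∫ z in D, divg F z = ∫ z in Ω, divg F z := by
    have hz : ∀ z, z ∉ Metric.ball x r → divg F z = 0 := fun z hz =>
      divg_eq_zero_of_notMem hK h0 fun h => hz (hKr h)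
    have hinter : D ∩ Metric.ball x r = Ω ∩ Metric.ball x r := by
      ext y
      exact ⟨fun h => ⟨(hDΩ y h.2).1 h.1, h.2⟩, fun h => ⟨(hDΩ y h.2).2 h.1, h.2⟩⟩
    rw [setIntegral_eq_of_subset_of_forall_sdiff_eq_zero hDo.measurableSet
      (inter_subset_left (t := Metric.ball x r))
        (fun z hz' => hz z fun h => hz'.2 ⟨hz'.1, h⟩), hinter,
      ← setIntegral_eq_of_subset_of_forall_sdiff_eq_zero hΩo.measurableSet
      (inter_subset_left (t := Metric.ball x r))
        (fun z hz' => hz z fun h => hz'.2 ⟨hz'.1, h⟩)]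
  set g : Fin d → Pt n × ℝ → ℝ := fun i z => F (Φ.symm z) i with hg
  have hgU : ∀ i, ContDiffOn ℝ 1 (g i) U := by
    intro i z hz
    have h1 : ContDiffAt ℝ 1 F (Φ.symm z) := hFΩ _ (by simpa [hΩ] using hz)
    have h2 : ContDiffAt ℝ 1 (fun z => F (Φ.symm z)) z :=
      h1.comp z Φ.symm.contDiff.contDiffAt
    exact ((EuclideanSpace.proj (𝕜 := ℝ) i).contDiff.contDiffAt.comp z h2).contDiffWithinAt
  have hgder : ∀ i, ∀ z ∈ U, ∀ w, fderiv ℝ (g i) z w = fderiv ℝ F (Φ.symm z) (Φ.symm w) i := by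
    intro i z hz w
    have h1 : DifferentiableAt ℝ F (Φ.symm z) :=
      (hFΩ _ (by simpa [hΩ] using hz)).differentiableAt one_ne_zero
    have h2 := (EuclideanSpace.proj (𝕜 := ℝ) i).hasFDerivAt.comp z
      (h1.hasFDerivAt.comp z Φ.symm.toContinuousLinearMap.hasFDerivAt)
    have h3 : fderiv ℝ (g i) z = _ := h2.fderiv
    rw [h3]; rfl
  have hgcl : ∀ i, ContinuousOn (g i) {z | γ z.1 ≤ z.2} := by
    intro i
    have h1 : ContinuousOn (fun z => F (Φ.symm z)) {z : Pt n × ℝ | γ z.1 ≤ z.2} :=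
      hFcl.comp Φ.symm.continuous.continuousOn fun z hz => by simpa using hz
    exact (EuclideanSpace.proj (𝕜 := ℝ) i).continuous.comp_continuousOn h1
  set K' : Set (Pt n × ℝ) := Φ '' K with hK'
  have hK'c : IsCompact K' := hK.image Φ.continuous
  have hg0 : ∀ i, ∀ z, z ∉ K' → g i z = 0 := by
    intro i z hz
    have : Φ.symm z ∉ K := fun h => hz ⟨_, h, by simp⟩
    simp [hg, h0 _ this]
  have hgC : ∀ i, ∀ z, γ z.1 < z.2 → ‖fderiv ℝ (g i) z‖ ≤
      max C 0 * ‖(Φ.symm : (Pt n × ℝ) →L[ℝ] Pt d)‖ := by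
    intro i z hz
    refine ContinuousLinearMap.opNorm_le_bound _ (by positivity) fun w => ?_
    rw [hgder i z hz w]
    refine (PiLp.norm_apply_le _ i).trans ?_
    refine (ContinuousLinearMap.le_opNorm _ _).trans ?_
    rw [mul_assoc]
    exact mul_le_mul (hCΩ _ (by simpa [hΩ, hU] using hz))
      ((Φ.symm : (Pt n × ℝ) →L[ℝ] Pt d).le_opNorm w) (norm_nonneg _) (le_max_right _ _)
  have hgcont : ∀ i, Continuous fun p => g i (p, γ p) := by
    intro i
    exact (hgcl i).comp_continuous (by fun_prop) fun p => le_refl (γ p)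
  have hgsupp : ∀ i, HasCompactSupport fun p => g i (p, γ p) := by
    intro i
    refine HasCompactSupport.intro (hK'c.image continuous_fst) fun p hp => ?_
    exact hg0 i _ fun h => hp ⟨_, h, rfl⟩
  have hγ' : Continuous (fderiv ℝ γ) := hγ.continuous_fderiv one_ne_zero
  have hstep2 : ∫ z in Ω, divg F z =
      ∑ i, ∫ z in U, fderiv ℝ (g i) z (Φ (EuclideanSpace.single i 1)) := by
    have h1 := hΦm.setIntegral_preimage_emb Φ.toHomeomorph.measurableEmbedding
      (fun z => divg F (Φ.symm z)) U
    simp only [ContinuousLinearEquiv.symm_apply_apply] at h1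
    rw [h1, ← integral_finsetSum]
    · refine setIntegral_congr_fun hUo.measurableSet fun z hz => ?_
      simp only [divg]
      refine Finset.sum_congr rfl fun i _ => ?_
      rw [hgder i z hz]; simp
    · intro i _
      refine integrableOn_of_bounded_of_compact (K := K')
        (C := max C 0 * ‖(Φ.symm : (Pt n × ℝ) →L[ℝ] Pt d)‖ * ‖Φ (EuclideanSpace.single i 1)‖)
        hUo.measurableSet ?_ ?_ hK'c ?_
      · exact ((hgU i).continuousOn_fderiv_of_isOpen hUo le_rfl).clm_apply continuousOn_const
      · intro z hz
        exact (ContinuousLinearMap.le_opNorm _ _).trans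
          (mul_le_mul_of_nonneg_right (hgC i z hz) (norm_nonneg _))
      · intro z _ hz
        have : g i =ᶠ[𝓝 z] fun _ => 0 := by
          filter_upwards [hK'c.isClosed.isOpen_compl.mem_nhds hz] with y hy using hg0 i y hy
        rw [this.fderiv_eq]; simp
  rw [hstep1, hstep2]
  -- The half-graph formula is applied to each Cartesian component of `F`, in the direction that
  -- represents the i-th basis vector in the chart. Summing over i recovers the chart components of
  -- `F`.
  rw [Finset.sum_congr rfl fun i _ => integral_fderiv_above_graph hγ (hgU i) (hgcl i) hK'c
    (hg0 i) (hgC i) (Φ (EuclideanSpace.single i 1)), ← integral_finsetSum]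
  · refine integral_congr_ae (Eventually.of_forall fun p => ?_)
    simp only
    have hsum : F (graphPt e γ p) =
        ∑ i, g i (p, γ p) • (EuclideanSpace.single i (1 : ℝ) : Pt d) := by
      ext j
      simp [hg, hΦg, Pi.single_apply]
    have h1 : Φ (F (graphPt e γ p)) = ∑ i, g i (p, γ p) • Φ (EuclideanSpace.single i (1 : ℝ)) := by
      rw [hsum, map_sum]; simp
    rw [← hΦ1, ← hΦ2, h1, Prod.fst_sum, Prod.snd_sum, map_sum, ← Finset.sum_sub_distrib]
    refine Finset.sum_congr rfl fun i _ => ?_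
    simp only [Prod.smul_fst, Prod.smul_snd, map_smul, smul_eq_mul]
    ring
  · intro i _
    refine Continuous.integrable_of_hasCompactSupport ?_ ((hgsupp i).mul_left)
    exact ((hγ'.clm_apply continuous_const).sub continuous_const).mul (hgcont i)

end Divergence

/-! ### The divergence inequality on a bounded domain -/

section Domain

variable {d k : ℕ} {D : Set (Pt d)}

theorem HasCkBoundary.uniqueDiffOn_closure (hk : 1 ≤ k) (hDo : IsOpen D)
    (hDk : HasCkBoundary k D) : UniqueDiffOn ℝ (closure D) := by
  intro x hx
  by_cases hxD : x ∈ D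
  · exact (hDo.uniqueDiffWithinAt hxD).mono subset_closure
  · have hxf : x ∈ frontier D := by rw [hDo.frontier_eq]; exact ⟨hx, hxD⟩
    obtain ⟨r, hr, e, γ, hγ, hloc⟩ := hDk x hxf
    have hγ1 : ContDiff ℝ 1 γ := hγ.of_le (by exact_mod_cast hk)
    exact (uniqueDiffWithinAt_of_chart hγ1 hloc hr
      ((mem_frontier_iff_of_chart hDo hγ1.continuous hloc (Metric.mem_ball_self hr)).1
        hxf)).mono subset_closure

theorem HasCkBoundary.isFiniteMeasure_surfaceMeasure (hk : 1 ≤ k) (hDo : IsOpen D)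
    (hDb : Bornology.IsBounded D) (hDk : HasCkBoundary k D) :
    IsFiniteMeasure (surfaceMeasure D) := by
  have hcomp : IsCompact (frontier D) :=
    hDb.isCompact_closure.of_isClosed_subset isClosed_frontier frontier_subset_closure
  refine ⟨?_⟩
  rw [surfaceMeasure, Measure.restrict_apply_univ]
  refine hcomp.measure_lt_top_of_nhdsWithin fun x hxf => ?_
  obtain ⟨r, hr, e, γ, hγ, hloc⟩ := hDk x hxf
  exact finiteAt_frontier_of_chart hDo (hγ.of_le (by exact_mod_cast hk)) hloc hr

theorem exists_norm_fderiv_le {E' : Type*} [NormedAddCommGroup E'] [NormedSpace ℝ E']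
    (hDo : IsOpen D) (hDb : Bornology.IsBounded D) (hU : UniqueDiffOn ℝ (closure D))
    {F : Pt d → E'} (hF : ContDiffOn ℝ 1 F (closure D)) : ∃ C, ∀ z ∈ D, ‖fderiv ℝ F z‖ ≤ C := by
  obtain ⟨C, hC⟩ := hDb.isCompact_closure.exists_bound_of_continuousOn
    (hF.continuousOn_fderivWithin hU le_rfl)
  refine ⟨C, fun z hz => ?_⟩
  rw [← fderivWithin_of_mem_nhds (mem_of_superset (hDo.mem_nhds hz) subset_closure)]
  exact hC z (subset_closure hz)

theorem integrableOn_divg (hDo : IsOpen D) (hDb : Bornology.IsBounded D)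
    (hU : UniqueDiffOn ℝ (closure D))
    {F : Pt d → Pt d} (hF : ContDiffOn ℝ 1 F (closure D)) : IntegrableOn (divg F) D := by
  have h1 : IntegrableOn (fun z => ∑ i, fderivWithin ℝ F (closure D) z
      (EuclideanSpace.single i 1) i) (closure D) := by
    refine ContinuousOn.integrableOn_compact hDb.isCompact_closure ?_
    refine continuousOn_finsetSum _ fun i _ => ?_
    exact (EuclideanSpace.proj (𝕜 := ℝ) i).continuous.comp_continuousOn
      ((hF.continuousOn_fderivWithin hU le_rfl).clm_apply continuousOn_const)
  refine (h1.mono_set subset_closure).congr_fun (fun z hz => ?_) hDo.measurableSet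
  simp only [divg, fderivWithin_of_mem_nhds (mem_of_superset (hDo.mem_nhds hz) subset_closure)]

theorem integrable_surfaceMeasure [IsFiniteMeasure (surfaceMeasure D)]
    (hDb : Bornology.IsBounded D) {h : Pt d → ℝ} (hh : ContinuousOn h (frontier D)) :
    Integrable h (surfaceMeasure D) := by
  have hcomp : IsCompact (frontier D) :=
    hDb.isCompact_closure.of_isClosed_subset isClosed_frontier frontier_subset_closure
  have h1 : IntegrableOn h (frontier D) (surfaceMeasure D) := hh.integrableOn_compact hcomp
  rwa [IntegrableOn, surfaceMeasure, Measure.restrict_restrict isClosed_frontier.measurableSet,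
    inter_self] at h1

theorem exists_pow_le {c : ℝ} (hc : 1 < c) (n : ℕ) :
    ∃ ε : ℝ≥0, 0 < ε ∧ (1 + (ε : ℝ)) ^ n ≤ c := by
  have h1 : Tendsto (fun ε : ℝ => (1 + ε) ^ n) (𝓝[>] 0) (𝓝 1) := by
    have : Continuous fun ε : ℝ => (1 + ε) ^ n := by fun_prop
    simpa using (this.tendsto 0).mono_left nhdsWithin_le_nhds
  obtain ⟨ε, hε, hε0⟩ := ((h1.eventually_le_const hc).and
    self_mem_nhdsWithin).exists
  exact ⟨⟨ε, le_of_lt hε0⟩, hε0, hε⟩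

/-- Near a boundary point the divergence inequality holds up to a factor arbitrarily close to `1`. -/
theorem exists_ball_abs_integral_divg_le_frontier [IsFiniteMeasure (surfaceMeasure D)] (hk : 1 ≤ k)
    (hDo : IsOpen D) (hDb : Bornology.IsBounded D) (hDk : HasCkBoundary k D) {x : Pt d}
    (hx : x ∈ frontier D) {c : ℝ} (hc : 1 < c) :
    ∃ ρ > 0, ∀ F : Pt d → Pt d, ContDiffOn ℝ 1 F (closure D) →
      ∀ K : Set (Pt d), IsCompact K → K ⊆ Metric.ball x ρ → (∀ z, z ∉ K → F z = 0) →
      |∫ z in D, divg F z| ≤ c * ∫ z, ‖F z‖ ∂(surfaceMeasure D) := by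
  have hU := hDk.uniqueDiffOn_closure hk hDo
  obtain ⟨r, hr, e, γ, hγk, hloc⟩ := hDk x hx
  have hγ : ContDiff ℝ 1 γ := hγk.of_le (by exact_mod_cast hk)
  have hγ' : Continuous (fderiv ℝ γ) := hγ.continuous_fderiv one_ne_zero
  -- The exponent counts d - 1 factors 1 + ε from the comparison of measures and one more from the
  -- bound on the flux density.
  obtain ⟨ε, hε, hεc⟩ := exists_pow_le hc (d - 1 + 1)
  set a : Pt (d - 1) := (InnerProductSpace.toDual ℝ (Pt (d - 1))).symm (fderiv ℝ γ (e x).fst)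
  have ha : innerSL ℝ a = fderiv ℝ γ (e x).fst :=
    (InnerProductSpace.toDual ℝ (Pt (d - 1))).apply_symm_apply _
  obtain ⟨s, hs, hsa⟩ := (((hγ.contDiffAt (x := (e x).fst)).hasStrictFDerivAt
    one_ne_zero)).approximates_deriv_on_nhds (c := ε) (Or.inr hε)
  rw [← ha] at hsa
  have hnear : ∀ᶠ p in 𝓝 (e x).fst, ‖fderiv ℝ γ p - innerSL ℝ a‖ < ε := by
    have h1 : Continuous fun p => ‖fderiv ℝ γ p - innerSL ℝ a‖ := by fun_prop
    refine h1.continuousAt.eventually_lt continuousAt_const ?_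
    simp [ha, hε]
  obtain ⟨δ, hδ, hδs⟩ := Metric.mem_nhds_iff.1 (inter_mem hs hnear)
  refine ⟨min r δ, lt_min hr hδ, fun F hF K hK hKρ h0 => ?_⟩
  obtain ⟨C, hC⟩ := exists_norm_fderiv_le hDo hDb hU hF
  have hFc : ContinuousOn F (closure D) := hF.continuousOn
  rw [integral_divg_eq_of_chart hDo hγ hloc (hF.mono subset_closure) hFc hC hK
    (hKρ.trans (Metric.ball_subset_ball (min_le_left _ _))) h0]
  set J := √(1 + ‖a‖ ^ 2) with hJ
  have hJ0 : 0 < J := by positivity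
  set V := graphPt e γ ⁻¹' Metric.ball x (min r δ) with hV
  have hΓ : Continuous (graphPt e γ) := (contDiff_graphPt e hγ).continuous
  have hVδ : ∀ p ∈ V, p ∈ Metric.ball (e x).fst δ := by
    intro p hp
    have h1 := (dist_fst_le e (graphPt e γ p) x).trans_lt (lt_of_lt_of_le hp (min_le_right _ _))
    simpa [graphPt] using h1
  have hVm : MeasurableSet V := (Metric.isOpen_ball.preimage hΓ).measurableSet
  have hmap : ENNReal.ofReal J • (volume.restrict V).map (graphPt e γ) ≤
      ((1 + ε : ℝ≥0) : ℝ≥0∞) ^ (d - 1) • surfaceMeasure D := map_graphPt_le hDo hγ hloc (min_le_left r δ) (min_le_right r δ)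
    (hsa.mono_set (hδs.trans inter_subset_left))
  set ν := (volume.restrict V).map (graphPt e γ) with hν
  have hFi : Integrable (fun z => ‖F z‖) (surfaceMeasure D) :=
    integrable_surfaceMeasure hDb (hFc.mono frontier_subset_closure).norm
  have hFi2 : Integrable (fun z => ‖F z‖)
      (((1 + ε : ℝ≥0) : ℝ≥0∞) ^ (d - 1) • surfaceMeasure D) :=
    hFi.smul_measure (by simp)
  have hFi3 : Integrable (fun z => ‖F z‖) (ENNReal.ofReal J • ν) := hFi2.mono_measure hmap
  have hle : J * ∫ z, ‖F z‖ ∂ν ≤ (1 + (ε : ℝ)) ^ (d - 1) * ∫ z, ‖F z‖ ∂(surfaceMeasure D) := by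
    have h1 := integral_mono_measure hmap (Eventually.of_forall fun z => norm_nonneg (F z)) hFi2
    rw [integral_smul_measure, integral_smul_measure, ENNReal.toReal_ofReal hJ0.le,
      ENNReal.toReal_pow, ENNReal.coe_toReal] at h1
    simpa only [smul_eq_mul, NNReal.coe_add, NNReal.coe_one] using h1
  have hJν : Integrable (fun z => ‖F z‖) ν := by
    rwa [integrable_smul_measure (by simpa using hJ0) (by simp)] at hFi3
  have hpull : ∫ z, ‖F z‖ ∂ν = ∫ p in V, ‖F (graphPt e γ p)‖ :=
    integral_map hΓ.aemeasurable hJν.aestronglyMeasurable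
  have hpulli : IntegrableOn (fun p => ‖F (graphPt e γ p)‖) V :=
    hJν.comp_measurable hΓ.measurable
  have hzero : ∀ p, p ∉ V → F (graphPt e γ p) = 0 := fun p hp => h0 _ fun h => hp (hKρ h)
  have h2 : |∫ p, (fderiv ℝ γ p (e (F (graphPt e γ p))).fst - (e (F (graphPt e γ p))).snd)| ≤
      ∫ p in V, (1 + ε) * J * ‖F (graphPt e γ p)‖ := by
    rw [← setIntegral_eq_integral_of_forall_compl_eq_zero (s := V)
      (fun p hp => by simp [hzero p hp]), ← Real.norm_eq_abs]
    refine norm_integral_le_of_norm_le (hpulli.const_mul _) ?_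
    filter_upwards [ae_restrict_mem hVm] with p hp
    have h3 := abs_fderiv_sub_le (a := a) (L := fderiv ℝ γ p) (ε := ε)
      (le_of_lt (hδs (hVδ p hp)).2) (e (F (graphPt e γ p)))
    rwa [e.norm_map] at h3
  refine h2.trans ?_
  rw [integral_const_mul, ← hpull, mul_assoc]
  have hnn : 0 ≤ ∫ z, ‖F z‖ ∂(surfaceMeasure D) := integral_nonneg fun z => norm_nonneg _
  calc (1 + (ε : ℝ)) * (J * ∫ z, ‖F z‖ ∂ν)
      ≤ (1 + (ε : ℝ)) * ((1 + (ε : ℝ)) ^ (d - 1) * ∫ z, ‖F z‖ ∂(surfaceMeasure D)) := by gcongr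
    _ = (1 + (ε : ℝ)) ^ (d - 1 + 1) * ∫ z, ‖F z‖ ∂(surfaceMeasure D) := by ring
    _ ≤ _ := by gcongr

theorem integral_divg_eq_zero (hDo : IsOpen D) {F : Pt d → Pt d} (hF : ContDiffOn ℝ 1 F D)
    {K : Set (Pt d)} (hK : IsCompact K) (hKD : K ⊆ D) (h0 : ∀ z, z ∉ K → F z = 0) :
    ∫ z in D, divg F z = 0 := by
  have hFall : ContDiff ℝ 1 F := by
    rw [contDiff_iff_contDiffAt]
    intro y
    by_cases hyK : y ∈ K
    · exact (hF y (hKD hyK)).contDiffAt (hDo.mem_nhds (hKD hyK))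
    · refine (contDiffAt_const (c := (0 : Pt d))).congr_of_eventuallyEq ?_
      filter_upwards [hK.isClosed.isOpen_compl.mem_nhds hyK] with z hz using h0 z hz
  rw [setIntegral_eq_integral_of_forall_compl_eq_zero
    fun z hz => divg_eq_zero_of_notMem hK h0 fun h => hz (hKD h)]
  have hcomp : ∀ i, ContDiff ℝ 1 fun z => F z i := fun i =>
    (EuclideanSpace.proj (𝕜 := ℝ) i).contDiff.comp hFall
  have hsupp : ∀ i, HasCompactSupport fun z => F z i := fun i =>
    HasCompactSupport.intro hK fun z hz => by simp [h0 z hz]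
  have hder : ∀ i z w, fderiv ℝ F z w i = fderiv ℝ (fun z => F z i) z w := by
    intro i z w
    have h2 := (EuclideanSpace.proj (𝕜 := ℝ) i).hasFDerivAt.comp z
      ((hFall.differentiable one_ne_zero) z).hasFDerivAt
    have h3 : fderiv ℝ (fun z => F z i) z = _ := h2.fderiv
    rw [h3]; rfl
  simp only [divg, hder]
  rw [integral_finsetSum]
  · exact Finset.sum_eq_zero fun i _ => integral_fderiv_apply_eq_zero (hcomp i) (hsupp i) _
  · intro i _
    exact (((hcomp i).continuous_fderiv one_ne_zero).clm_apply
      continuous_const).integrable_of_hasCompactSupport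
        ((hsupp i).fderiv_apply (𝕜 := ℝ) _)

/-- The divergence inequality `|∫_D div F| ≤ ∫_{∂D} |F| ds` on a bounded domain with `C¹`
boundary. -/
theorem abs_integral_divg_le (hk : 1 ≤ k) (hDo : IsOpen D) (hDb : Bornology.IsBounded D)
    (hDk : HasCkBoundary k D) {F : Pt d → Pt d} (hF : ContDiffOn ℝ 1 F (closure D)) :
    |∫ z in D, divg F z| ≤ ∫ z, ‖F z‖ ∂(surfaceMeasure D) := by
  have hfin := hDk.isFiniteMeasure_surfaceMeasure hk hDo hDb
  have hU := hDk.uniqueDiffOn_closure hk hDo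
  have hnn : 0 ≤ ∫ z, ‖F z‖ ∂(surfaceMeasure D) := integral_nonneg fun z => norm_nonneg _
  -- Charts are only almost isometric to their linearization, so an arbitrary factor c > 1 is
  -- allowed locally and sent to 1 at the end.
  suffices h : ∀ c : ℝ, 1 < c →
      |∫ z in D, divg F z| ≤ c * ∫ z, ‖F z‖ ∂(surfaceMeasure D) by
    have hlim : Tendsto (fun c : ℝ => c * ∫ z, ‖F z‖ ∂(surfaceMeasure D)) (𝓝[>] 1)
        (𝓝 (1 * ∫ z, ‖F z‖ ∂(surfaceMeasure D))) :=
      ((continuous_id.mul continuous_const).tendsto 1).mono_left nhdsWithin_le_nhds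
    rw [one_mul] at hlim
    exact ge_of_tendsto hlim (by filter_upwards [self_mem_nhdsWithin] with c hc using h c hc)
  intro c hc
  have hlocal : ∀ x ∈ closure D, ∃ ρ > 0, ∀ G : Pt d → Pt d, ContDiffOn ℝ 1 G (closure D) →
      ∀ K : Set (Pt d), IsCompact K → K ⊆ Metric.ball x ρ → (∀ z, z ∉ K → G z = 0) →
      |∫ z in D, divg G z| ≤ c * ∫ z, ‖G z‖ ∂(surfaceMeasure D) := by
    intro x hx
    by_cases hxD : x ∈ D
    · obtain ⟨ρ, hρ, hρD⟩ := Metric.isOpen_iff.1 hDo x hxD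
      refine ⟨ρ, hρ, fun G hG K hK hKρ h0 => ?_⟩
      rw [integral_divg_eq_zero hDo (hG.mono subset_closure) hK (hKρ.trans hρD) h0, abs_zero]
      have : 0 ≤ ∫ z, ‖G z‖ ∂(surfaceMeasure D) := integral_nonneg fun z => norm_nonneg _
      positivity
    · exact exists_ball_abs_integral_divg_le_frontier hk hDo hDb hDk
        (by rw [hDo.frontier_eq]; exact ⟨hx, hxD⟩) hc
  choose! ρ hρ hρF using hlocal
  obtain ⟨t, htD, htcov⟩ := hDb.isCompact_closure.elim_nhds_subcover
    (fun x => Metric.ball x (ρ x)) fun x hx => Metric.ball_mem_nhds x (hρ x hx)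
  obtain ⟨f, hf⟩ := SmoothPartitionOfUnity.exists_isSubordinate 𝓘(ℝ, Pt d)
    (s := closure D) isClosed_closure (fun x : t => Metric.ball (x : Pt d) (ρ x))
    (fun x => Metric.isOpen_ball) (fun z hz => by
      obtain ⟨x, hx, hzx⟩ := mem_iUnion₂.1 (htcov hz)
      exact mem_iUnion.2 ⟨⟨x, hx⟩, hzx⟩)
  have hfs : ∀ i, ContDiff ℝ 1 (f i) := fun i =>
    ((f i).contMDiff.contDiff).of_le (by exact_mod_cast le_top)
  have hsum : ∀ z ∈ closure D, ∑ i, f i z = 1 := by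
    intro z hz
    rw [← finsum_eq_sum_of_fintype]
    exact f.sum_eq_one hz
  have hGs : ∀ i, ContDiffOn ℝ 1 (fun z => f i z • F z) (closure D) := fun i =>
    (hfs i).contDiffOn.smul hF
  have hloc : ∀ i, |∫ z in D, divg (fun z => f i z • F z) z| ≤
      c * ∫ z, f i z * ‖F z‖ ∂(surfaceMeasure D) := by
    intro i
    have h1 := hρF i (htD i i.2) (fun z => f i z • F z) (hGs i) (tsupport (f i))
      (Metric.isCompact_of_isClosed_isBounded (isClosed_tsupport _)
        (Metric.isBounded_ball.subset (hf i))) (hf i)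
      (fun z hz => by
        have : f i z = 0 := image_eq_zero_of_notMem_tsupport hz
        simp [this])
    simpa only [norm_smul, Real.norm_of_nonneg (f.nonneg i _)] using h1
  have hdiv : ∀ z ∈ D, divg F z = ∑ i, divg (fun z => f i z • F z) z := by
    intro z hz
    have hev : F =ᶠ[𝓝 z] fun z => ∑ i, f i z • F z := by
      filter_upwards [hDo.mem_nhds hz] with y hy
      rw [← Finset.sum_smul, hsum y (subset_closure hy), one_smul]
    have hd : ∀ i ∈ Finset.univ, DifferentiableAt ℝ (fun z => f i z • F z) z := fun i _ =>
      (((hGs i).mono subset_closure).differentiableOn one_ne_zero).differentiableAt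
        (hDo.mem_nhds hz)
    simp only [divg]
    rw [Finset.sum_comm]
    refine Finset.sum_congr rfl fun j _ => ?_
    rw [hev.fderiv_eq, fderiv_fun_sum hd]
    simp
  have hint : ∫ z in D, divg F z = ∑ i, ∫ z in D, divg (fun z => f i z • F z) z := by
    rw [setIntegral_congr_fun hDo.measurableSet hdiv, integral_finsetSum]
    exact fun i _ => integrableOn_divg hDo hDb hU (hGs i)
  have hFi : ∀ i, Integrable (fun z => f i z * ‖F z‖) (surfaceMeasure D) := fun i =>
    integrable_surfaceMeasure hDb
      ((hfs i).continuous.continuousOn.mul (hF.continuousOn.mono frontier_subset_closure).norm)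
  -- The cutoffs are nonnegative and sum to 1 on the boundary, so the local right-hand sides add up
  -- exactly, however many charts there are.
  have hbd : ∫ z, ‖F z‖ ∂(surfaceMeasure D) = ∑ i, ∫ z, f i z * ‖F z‖ ∂(surfaceMeasure D) := by
    rw [← integral_finsetSum _ fun i _ => hFi i]
    refine setIntegral_congr_fun isClosed_frontier.measurableSet fun z hz => ?_
    rw [← Finset.sum_mul, hsum z (frontier_subset_closure hz), one_mul]
  rw [hint, hbd, Finset.mul_sum]
  exact (Finset.abs_sum_le_sum_abs _ _).trans (Finset.sum_le_sum fun i _ => hloc i)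

end Domain

/-! ### Time slices of continuous functions, for finite measures carried by a compact set -/

section Slices

theorem restrict_eq_self_of_null_compl {X : Type*} [MeasurableSpace X] {μ : Measure X} {K : Set X}
    (hμ : μ Kᶜ = 0) : μ.restrict K = μ :=
  Measure.restrict_eq_self_of_ae_mem (by rwa [ae_iff])

variable {X : Type*} [MetricSpace X] [MeasurableSpace X] [BorelSpace X] {μ : Measure X} [IsFiniteMeasure μ] {K : Set X}

theorem integrable_of_continuous (hK : IsCompact K) (hμ : μ Kᶜ = 0) {h : X → ℝ}
    (hh : Continuous h) : Integrable h μ := by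
  have h1 : IntegrableOn h K μ := hh.continuousOn.integrableOn_compact hK
  rwa [IntegrableOn, restrict_eq_self_of_null_compl hμ] at h1

theorem continuous_integral_slice (hK : IsCompact K) (hμ : μ Kᶜ = 0) {Y : Type*}
    [TopologicalSpace Y] [FirstCountableTopology Y] [LocallyCompactSpace Y] {H : X × Y → ℝ}
    (hH : Continuous H) : Continuous fun t => ∫ x, H (x, t) ∂μ := by
  have h1 := continuous_parametric_integral_of_continuous (μ := μ)
    (f := fun t x => H (x, t)) (by fun_prop) hK
  rwa [restrict_eq_self_of_null_compl hμ] at h1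

theorem interval_integral_swap [SecondCountableTopology X] (hK : IsCompact K) (hμ : μ Kᶜ = 0) {H : X × ℝ → ℝ}
    (hH : Continuous H) (a b : ℝ) :
    ∫ t in a..b, (∫ x, H (x, t) ∂μ) = ∫ x, (∫ t in a..b, H (x, t)) ∂μ := by
  refine intervalIntegral_integral_swap (f := fun t x => H (x, t)) ?_
  have h1 : IntegrableOn (Function.uncurry fun t x => H (x, t)) (uIcc a b ×ˢ K)
      ((volume : Measure ℝ).prod μ) :=
    (by fun_prop : Continuous (Function.uncurry fun t x => H (x, t))).continuousOn.integrableOn_compact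
      (isCompact_uIcc.prod hK)
  rw [IntegrableOn, ← Measure.prod_restrict, restrict_eq_self_of_null_compl hμ] at h1
  exact h1.mono_measure (Measure.prod_mono (Measure.restrict_mono uIoc_subset_uIcc le_rfl) le_rfl)

end Slices

/-! ### Cauchy–Schwarz inequalities and the integral of a function times its primitive -/

section CauchySchwarz

theorem integral_mul_sq_le {X : Type*} [MeasurableSpace X] {μ : Measure X} {f g : X → ℝ}
    (hf : Integrable (fun x => f x ^ 2) μ) (hg : Integrable (fun x => g x ^ 2) μ)
    (hfg : Integrable (fun x => f x * g x) μ) :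
    (∫ x, f x * g x ∂μ) ^ 2 ≤ (∫ x, f x ^ 2 ∂μ) * ∫ x, g x ^ 2 ∂μ := by
  have h : ∀ t : ℝ, 0 ≤ (∫ x, g x ^ 2 ∂μ) * (t * t) + (2 * ∫ x, f x * g x ∂μ) * t
      + ∫ x, f x ^ 2 ∂μ := by
    intro t
    have h1 : 0 ≤ ∫ x, (f x + t * g x) ^ 2 ∂μ := integral_nonneg fun x => sq_nonneg _
    have h2 : ∀ x, (f x + t * g x) ^ 2
        = (t * t) * g x ^ 2 + (2 * t) * (f x * g x) + f x ^ 2 := fun x => by ring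
    simp_rw [h2] at h1
    rw [integral_add (by exact (hg.const_mul _).add (hfg.const_mul _)) hf,
      integral_add (hg.const_mul _) (hfg.const_mul _), integral_const_mul, integral_const_mul] at h1
    linarith
  have h3 := discrim_le_zero h
  rw [discrim] at h3
  nlinarith

theorem integral_mul_le_sqrt {X : Type*} [MeasurableSpace X] {μ : Measure X} {f g : X → ℝ}
    (hf : Integrable (fun x => f x ^ 2) μ) (hg : Integrable (fun x => g x ^ 2) μ)
    (hfg : Integrable (fun x => f x * g x) μ) :
    ∫ x, f x * g x ∂μ ≤ √(∫ x, f x ^ 2 ∂μ) * √(∫ x, g x ^ 2 ∂μ) := by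
  rw [← Real.sqrt_mul (integral_nonneg fun x => sq_nonneg _)]
  exact Real.le_sqrt_of_sq_le (integral_mul_sq_le hf hg hfg)

theorem intervalIntegral_le_sqrt {T : ℝ} (hT : 0 ≤ T) {f : ℝ → ℝ} (hf : Continuous f) :
    ∫ t in (0 : ℝ)..T, f t ≤ √T * √(∫ t in (0 : ℝ)..T, f t ^ 2) := by
  have h := integral_mul_le_sqrt (μ := volume.restrict (Ioc 0 T)) (f := fun _ => 1) (g := f)
    (continuous_const.integrableOn_Ioc) ((hf.pow 2).integrableOn_Ioc)
    ((continuous_const.mul hf).integrableOn_Ioc)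
  simpa [← intervalIntegral.integral_of_le hT, hT] using h

/-- The integrand is the derivative of half the squared primitive. This gives the sign of the
dissipation and the factor 1/2 in the reaction term of the multiplier estimate. -/
theorem integral_mul_primitive {φ : ℝ → ℝ} (hφ : Continuous φ) (T : ℝ) :
    ∫ t in (0 : ℝ)..T, φ t * ∫ s in (0 : ℝ)..t, φ s = (∫ s in (0 : ℝ)..T, φ s) ^ 2 / 2 := by
  have hd : ∀ t, HasDerivAt (fun t => (∫ s in (0 : ℝ)..t, φ s) ^ 2 / 2)
      (φ t * ∫ s in (0 : ℝ)..t, φ s) t := by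
    intro t
    have h1 := ((hφ.integral_hasStrictDerivAt 0 t).hasDerivAt.pow 2).div_const 2
    exact h1.congr_deriv (by push_cast; ring)
  have hc : Continuous fun t => φ t * ∫ s in (0 : ℝ)..t, φ s :=
    hφ.mul (continuous_iff_continuousAt.2 fun t =>
      (hφ.integral_hasStrictDerivAt 0 t).hasDerivAt.continuousAt)
  rw [intervalIntegral.integral_eq_sub_of_hasDerivAt (fun t _ => hd t)
    (hc.intervalIntegrable _ _)]
  simp

end CauchySchwarz

/-! ### Scalar inequalities for the constant C_1 -/

section Scalar

/-- Immediate once s² ≥ 2. Otherwise e^(1-s) ≥ 2 - s gives e^s (2 - s) ≤ e < 2.72, and it remains to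
see that 2.72 (2 - s²) ≤ 4 - s², which holds for s ≥ 1. -/
theorem two_mul_exp_sub_one_le {s : ℝ} (hs : 1 ≤ s) :
    2 * (Real.exp s - 1) ≤ s + s ^ 2 * Real.exp s := by
  rcases le_or_gt 2 (s ^ 2) with h | h
  · nlinarith [Real.exp_pos s]
  · have hs2 : s < 2 := by nlinarith
    have h1 : Real.exp (s - 1) * (2 - s) ≤ 1 := by
      have h2 := Real.add_one_le_exp (1 - s)
      calc Real.exp (s - 1) * (2 - s) ≤ Real.exp (s - 1) * Real.exp (1 - s) := by
            gcongr; linarith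
        _ = 1 := by rw [← Real.exp_add]; simp
    have h3 : Real.exp s = Real.exp 1 * Real.exp (s - 1) := by rw [← Real.exp_add]; simp
    have h4 := Real.exp_one_lt_d9
    have h5 : 0 < Real.exp (s - 1) := Real.exp_pos _
    have h6 : Real.exp s * (2 - s) ≤ 2.72 := by
      rw [h3, mul_assoc]
      nlinarith [Real.exp_pos 1]
    have h7 : (2 - s ^ 2) * (Real.exp s * (2 - s)) ≤ (2 + s) * (2 - s) := by nlinarith
    have h8 : (2 - s ^ 2) * Real.exp s ≤ 2 + s := by
      have : 0 < 2 - s := by linarith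
      nlinarith
    linarith

/-- With s = (1 + 2 Cf) T the square of C_1 is T (1 + s e^s); the hypothesis ensures s ≥ 1. This is
what absorbs the doubled boundary term of the Gronwall estimate. -/
theorem const1_le_of_large {T Cf : ℝ} (hT : 0 < T) (h : 1 ≤ 2 * (Cf * T)) :
    2 * (T * ((Real.exp ((1 + 2 * Cf) * T) - 1) / ((1 + 2 * Cf) * T))) ≤ const1 T Cf ^ 2 := by
  set s := (1 + 2 * Cf) * T with hs
  have hs1 : 1 ≤ s := by rw [hs]; nlinarith
  have hL : 0 < 1 + 2 * Cf := by nlinarith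
  rw [const1, Real.sq_sqrt (by positivity), ← hs]
  have h1 := two_mul_exp_sub_one_le hs1
  have h2 : T + (1 + 2 * Cf) * T ^ 2 * Real.exp s = T * ((s + s ^ 2 * Real.exp s) / s) := by
    have : s ≠ 0 := by linarith
    field_simp
    rw [hs]; ring
  rw [h2, ← mul_left_comm, ← mul_div_assoc]
  gcongr

theorem sqrt_le_const1 {T Cf : ℝ} (hT : 0 < T) (hCf : 0 ≤ Cf) : √T ≤ const1 T Cf := by
  refine Real.sqrt_le_sqrt ?_
  have : 0 ≤ (1 + 2 * Cf) * T ^ 2 * Real.exp ((1 + 2 * Cf) * T) := by positivity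
  linarith

/-- With x = Cf T, the bound e^(T+2x) ≥ 1 + T gives C_1² ≥ T (1 + (T + 2x)(1 + T)). The first claim
then rests on (1 - x/2)² (1 + 2x) ≥ 1 for 0 ≤ x ≤ 1/2. The second rests on 1 - x/2 ≥ 3/4 and T ≤
(9/16)(1 + T + T²). -/
theorem const1_ge_of_small {T Cf : ℝ} (hT : 0 < T) (hCf : 0 ≤ Cf) (h : Cf * T ≤ 1 / 2) :
    √T ≤ (1 - Cf * T / 2) * const1 T Cf ∧ T ≤ (1 - Cf * T / 2) * const1 T Cf := by
  set x := Cf * T with hx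
  have hx0 : 0 ≤ x := by positivity
  have hκ : 0 < 1 - x / 2 := by linarith
  have he := Real.add_one_le_exp ((1 + 2 * Cf) * T)
  have hs : (1 + 2 * Cf) * T = T + 2 * x := by rw [hx]; ring
  rw [hs] at he
  have hlow : T * (1 + (T + 2 * x) * (1 + T)) ≤
      T + (1 + 2 * Cf) * T ^ 2 * Real.exp ((1 + 2 * Cf) * T) := by
    have h1 : (1 + 2 * Cf) * T ^ 2 = T * (T + 2 * x) := by rw [← hs]; ring
    rw [h1, hs]
    have h2 : 1 + T ≤ Real.exp (T + 2 * x) := by linarith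
    have h3 : 0 ≤ T * (T + 2 * x) := by positivity
    nlinarith
  constructor
  · rw [const1, ← Real.sqrt_sq hκ.le, ← Real.sqrt_mul (by positivity)]
    refine Real.sqrt_le_sqrt ?_
    refine le_trans ?_ (mul_le_mul_of_nonneg_left hlow (by positivity))
    have h4 : 1 ≤ (1 - x / 2) ^ 2 * (1 + 2 * x) := by nlinarith [mul_nonneg hx0 hx0]
    have h5 : (1 + 2 * x) ≤ (1 + (T + 2 * x) * (1 + T)) := by nlinarith [mul_nonneg hx0 hT.le]
    have h6 : 1 ≤ (1 - x / 2) ^ 2 * (1 + (T + 2 * x) * (1 + T)) :=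
      h4.trans (mul_le_mul_of_nonneg_left h5 (by positivity))
    nlinarith
  · rw [const1, ← Real.sqrt_sq hκ.le, ← Real.sqrt_mul (by positivity)]
    refine Real.le_sqrt_of_sq_le ?_
    refine le_trans ?_ (mul_le_mul_of_nonneg_left hlow (by positivity))
    have h4 : (9 / 16 : ℝ) ≤ (1 - x / 2) ^ 2 := by nlinarith
    have h5 : 1 + T + T ^ 2 ≤ (1 + (T + 2 * x) * (1 + T)) := by nlinarith [mul_nonneg hx0 hT.le]
    have h6 : 9 / 16 * (1 + T + T ^ 2) ≤ (1 - x / 2) ^ 2 * (1 + (T + 2 * x) * (1 + T)) := by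
      gcongr
    have h7 : T ≤ 9 / 16 * (1 + T + T ^ 2) := by nlinarith [sq_nonneg (T - 1)]
    nlinarith

end Scalar

/-! ### The abstract energy argument -/

/-- The integrated form of the equation `w_t = l + R + F`, `|F| ≤ Cf |w|`, where `l` is the
Laplacian of `w`, known only through Green's inequality, and `q` is the spatial gradient of `w`. -/
structure EnergySystem {X ι : Type*} [Fintype ι] [TopologicalSpace X] [MeasurableSpace X]
    (μ ν : Measure X) (T M Cf : ℝ) (w p l R : X × ℝ → ℝ) (q : ι → X × ℝ → ℝ) : Prop where
  continuous_w : Continuous w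
  continuous_p : Continuous p
  continuous_l : Continuous l
  continuous_R : Continuous R
  continuous_q : ∀ i, Continuous (q i)
  eq_add_integral : ∀ᵐ x ∂μ, ∀ t ∈ Icc 0 T, w (x, t) = w (x, 0) + ∫ s in (0 : ℝ)..t, p (x, s)
  green : ∀ t ∈ Ioo 0 T, ∀ s ∈ Ioo 0 T,
    ∫ x, w (x, t) * l (x, s) ∂μ + ∫ x, ∑ i, q i (x, t) * q i (x, s) ∂μ
      ≤ M * ∫ x, |w (x, t)| ∂ν
  reaction : ∀ t ∈ Ioo 0 T, ∀ᵐ x ∂μ, |p (x, t) - l (x, t) - R (x, t)| ≤ Cf * |w (x, t)|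

namespace EnergySystem

variable {X ι : Type*} [Fintype ι] [MetricSpace X] [MeasurableSpace X] [BorelSpace X]
  {μ ν : Measure X}
  {K : Set X} {T M Cf : ℝ} {w p l R : X × ℝ → ℝ} {q : ι → X × ℝ → ℝ}

/-- The two times are kept independent: s = t serves Gronwall's argument, s < t the multiplier
argument. -/
theorem integral_mul_le [IsFiniteMeasure μ] (hS : EnergySystem μ ν T M Cf w p l R q) (hK : IsCompact K)
    (hμ : μ Kᶜ = 0) (hCf : 0 ≤ Cf) {t s : ℝ} (ht : t ∈ Ioo 0 T) (hs : s ∈ Ioo 0 T) :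
    ∫ x, w (x, t) * p (x, s) ∂μ ≤ M * ∫ x, |w (x, t)| ∂ν
      - ∫ x, ∑ i, q i (x, t) * q i (x, s) ∂μ
      + √(∫ x, w (x, t) ^ 2 ∂μ) * √(∫ x, R (x, s) ^ 2 ∂μ)
      + Cf * (√(∫ x, w (x, t) ^ 2 ∂μ) * √(∫ x, w (x, s) ^ 2 ∂μ)) := by
  have cw := hS.continuous_w
  have cp := hS.continuous_p
  have cl := hS.continuous_l
  have cR := hS.continuous_R
  have int : ∀ {h : X → ℝ}, Continuous h → Integrable h μ := integrable_of_continuous hK hμ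
  have h1 : ∫ x, w (x, t) * p (x, s) ∂μ ≤ ∫ x, (w (x, t) * l (x, s)
      + |w (x, t)| * |R (x, s)| + Cf * (|w (x, t)| * |w (x, s)|)) ∂μ := by
    refine integral_mono_ae (int (by fun_prop)) (int (by fun_prop)) ?_
    filter_upwards [hS.reaction s hs] with x hx
    have h2 : w (x, t) * p (x, s) = w (x, t) * l (x, s) + w (x, t) * R (x, s)
        + w (x, t) * (p (x, s) - l (x, s) - R (x, s)) := by ring
    have h3 : w (x, t) * R (x, s) ≤ |w (x, t)| * |R (x, s)| := by
      rw [← abs_mul]; exact le_abs_self _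
    have h4 : w (x, t) * (p (x, s) - l (x, s) - R (x, s)) ≤
        |w (x, t)| * (Cf * |w (x, s)|) := by
      refine (le_abs_self _).trans ?_
      rw [abs_mul]; gcongr
    rw [h2]
    linarith
  rw [integral_add (int (by fun_prop)) (int (by fun_prop)),
    integral_add (int (by fun_prop)) (int (by fun_prop)), integral_const_mul] at h1
  have h5 := hS.green t ht s hs
  have h6 := integral_mul_le_sqrt (μ := μ) (f := fun x => |w (x, t)|) (g := fun x => |R (x, s)|)
    (int (by fun_prop)) (int (by fun_prop)) (int (by fun_prop))
  have h7 := integral_mul_le_sqrt (μ := μ) (f := fun x => |w (x, t)|) (g := fun x => |w (x, s)|)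
    (int (by fun_prop)) (int (by fun_prop)) (int (by fun_prop))
  simp only [sq_abs] at h6 h7
  have h8 := mul_le_mul_of_nonneg_left h7 hCf
  linarith

/-- Cauchy–Schwarz twice, over the boundary and over time; this is the origin of |∂D|^{1/2} and
T^{1/2} in C_2. -/
theorem integral_abs_le [IsFiniteMeasure ν] (hS : EnergySystem μ ν T M Cf w p l R q) (hK : IsCompact K)
    (hν : ν Kᶜ = 0) (hT : 0 ≤ T) :
    ∫ t in (0 : ℝ)..T, (∫ x, |w (x, t)| ∂ν) ≤
      √(ν.real univ) * √T * √(∫ t in (0 : ℝ)..T, (∫ x, w (x, t) ^ 2 ∂ν)) := by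
  have cw := hS.continuous_w
  have int : ∀ {h : X → ℝ}, Continuous h → Integrable h ν := integrable_of_continuous hK hν
  have c1 : Continuous fun t => ∫ x, |w (x, t)| ∂ν :=
    continuous_integral_slice hK hν (H := fun z => |w z|) (by fun_prop)
  have c2 : Continuous fun t => ∫ x, w (x, t) ^ 2 ∂ν :=
    continuous_integral_slice hK hν (H := fun z => w z ^ 2) (by fun_prop)
  have h1 : ∀ t, ∫ x, |w (x, t)| ∂ν ≤ √(ν.real univ) * √(∫ x, w (x, t) ^ 2 ∂ν) := by
    intro t
    have h := integral_mul_le_sqrt (μ := ν) (f := fun _ => 1) (g := fun x => |w (x, t)|)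
      (int (by fun_prop)) (int (by fun_prop)) (int (by fun_prop))
    simpa using h
  calc ∫ t in (0 : ℝ)..T, (∫ x, |w (x, t)| ∂ν)
      ≤ ∫ t in (0 : ℝ)..T, √(ν.real univ) * √(∫ x, w (x, t) ^ 2 ∂ν) :=
        intervalIntegral.integral_mono_on hT (c1.intervalIntegrable _ _)
          ((continuous_const.mul c2.sqrt).intervalIntegrable _ _) fun t _ => h1 t
    _ = √(ν.real univ) * ∫ t in (0 : ℝ)..T, √(∫ x, w (x, t) ^ 2 ∂ν) := by
        rw [intervalIntegral.integral_const_mul]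
    _ ≤ √(ν.real univ) * (√T * √(∫ t in (0 : ℝ)..T, √(∫ x, w (x, t) ^ 2 ∂ν) ^ 2)) := by
        gcongr
        exact intervalIntegral_le_sqrt hT c2.sqrt
    _ = _ := by
        rw [mul_assoc]
        congr 4
        ext t
        exact Real.sq_sqrt (integral_nonneg fun x => sq_nonneg _)

/-- Pairing w(t) with w(0) + ∫_0^t w_s ds, rather than differentiating ‖w‖², gives the boundary flux
at time t the weight t ≤ T without a factor 2. After integration in t the dissipation and the
reaction terms have the form of a function times its primitive. -/
theorem energy_le_of_multiplier [SecondCountableTopology X] [IsFiniteMeasure μ]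
    [IsFiniteMeasure ν] (hS : EnergySystem μ ν T M Cf w p l R q) (hK : IsCompact K)
    (hμ : μ Kᶜ = 0) (hν : ν Kᶜ = 0) (hT : 0 < T) (hM : 0 ≤ M) (hCf : 0 ≤ Cf) :
    ∫ t in (0 : ℝ)..T, (∫ x, w (x, t) ^ 2 ∂μ) ≤
      (√T * √(∫ x, w (x, 0) ^ 2 ∂μ) + T * √(∫ t in (0 : ℝ)..T, (∫ x, R (x, t) ^ 2 ∂μ)))
          * √(∫ t in (0 : ℝ)..T, (∫ x, w (x, t) ^ 2 ∂μ))
        + T * (M * (√(ν.real univ) * √T * √(∫ t in (0 : ℝ)..T, (∫ x, w (x, t) ^ 2 ∂ν))))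
        + Cf * T / 2 * ∫ t in (0 : ℝ)..T, (∫ x, w (x, t) ^ 2 ∂μ) := by
  have cw := hS.continuous_w
  have cp := hS.continuous_p
  have cl := hS.continuous_l
  have cR := hS.continuous_R
  have cq := hS.continuous_q
  have int : ∀ {h : X → ℝ}, Continuous h → Integrable h μ := integrable_of_continuous hK hμ
  set y : ℝ → ℝ := fun t => ∫ x, w (x, t) ^ 2 ∂μ with hy
  set n : ℝ → ℝ := fun t => √(y t) with hn
  set ρ : ℝ → ℝ := fun t => √(∫ x, R (x, t) ^ 2 ∂μ) with hρ
  set a : ℝ → ℝ := fun t => ∫ x, |w (x, t)| ∂ν with ha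
  set J : ℝ → ℝ := fun t => ∫ s in (0 : ℝ)..t, n s with hJ
  set Q : X × ℝ → ℝ := fun z => ∑ i, q i z * ∫ s in (0 : ℝ)..z.2, q i (z.1, s) with hQ
  set P : ℝ → ℝ := fun t => ∫ x, Q (x, t) ∂μ with hP
  have cy : Continuous y := continuous_integral_slice hK hμ (H := fun z => w z ^ 2) (by fun_prop)
  have cn : Continuous n := cy.sqrt
  have cρ : Continuous ρ :=
    (continuous_integral_slice hK hμ (H := fun z => R z ^ 2) (by fun_prop)).sqrt
  have ca : Continuous a := continuous_integral_slice hK hν (H := fun z => |w z|) (by fun_prop)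
  have cJ : Continuous J := intervalIntegral.continuous_primitive
    (fun a b => cn.intervalIntegrable a b) 0
  have cQ : Continuous Q := by
    refine continuous_finsetSum _ fun i _ => (cq i).mul ?_
    have := cq i
    exact intervalIntegral.continuous_parametric_intervalIntegral_of_continuous
      (f := fun (z : X × ℝ) s => q i (z.1, s)) (by fun_prop) continuous_snd
  have cP : Continuous P := continuous_integral_slice hK hμ cQ
  have hy0 : ∀ t, 0 ≤ y t := fun t => integral_nonneg fun x => sq_nonneg _
  have hn0 : ∀ t, 0 ≤ n t := fun t => Real.sqrt_nonneg _
  have ha0 : ∀ t, 0 ≤ a t := fun t => integral_nonneg fun x => abs_nonneg _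
  have hρT : ∀ t ∈ Ioo 0 T, ∫ s in (0 : ℝ)..t, ρ s ≤ ∫ s in (0 : ℝ)..T, ρ s := by
    intro t ht
    exact intervalIntegral.integral_mono_interval le_rfl ht.1.le ht.2.le
      (Eventually.of_forall fun s => Real.sqrt_nonneg _) (cρ.intervalIntegrable _ _)
  have hpt : ∀ t ∈ Ioo 0 T, y t ≤ n t * n 0 + T * (M * a t) - P t
      + n t * (∫ s in (0 : ℝ)..T, ρ s) + Cf * (n t * J t) := by
    intro t ht
    have h1 : y t = ∫ x, w (x, t) * w (x, 0) ∂μ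
        + ∫ s in (0 : ℝ)..t, (∫ x, w (x, t) * p (x, s) ∂μ) := by
      rw [interval_integral_swap hK hμ (H := fun z => w (z.1, t) * p z) (by fun_prop)]
      rw [← integral_add (int (by fun_prop)) (int ?_)]
      · refine integral_congr_ae ?_
        filter_upwards [hS.eq_add_integral] with x hx
        rw [intervalIntegral.integral_const_mul, ← mul_add, ← hx t ⟨ht.1.le, ht.2.le⟩, sq]
      · exact intervalIntegral.continuous_parametric_intervalIntegral_of_continuous'
          (f := fun x s => w (x, t) * p (x, s)) (by fun_prop) 0 t
    have h2 : ∫ x, w (x, t) * w (x, 0) ∂μ ≤ n t * n 0 :=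
      integral_mul_le_sqrt (int (by fun_prop)) (int (by fun_prop)) (int (by fun_prop))
    have cI : Continuous fun s => ∫ x, ∑ i, q i (x, t) * q i (x, s) ∂μ :=
      continuous_integral_slice hK hμ (H := fun z => ∑ i, q i (z.1, t) * q i z) (by fun_prop)
    have h3 : ∫ s in (0 : ℝ)..t, (∫ x, w (x, t) * p (x, s) ∂μ) ≤
        ∫ s in (0 : ℝ)..t, (M * a t - (∫ x, ∑ i, q i (x, t) * q i (x, s) ∂μ)
          + n t * ρ s + Cf * (n t * n s)) := by
      refine intervalIntegral.integral_mono_on_of_le_Ioo ht.1.le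
        (Continuous.intervalIntegrable (continuous_integral_slice hK hμ
          (H := fun z => w (z.1, t) * p z) (by fun_prop)) _ _)
        (Continuous.intervalIntegrable (by fun_prop) _ _) fun s hs => ?_
      exact hS.integral_mul_le hK hμ hCf ht ⟨hs.1, hs.2.trans ht.2⟩
    have h4 : ∫ s in (0 : ℝ)..t, (∫ x, ∑ i, q i (x, t) * q i (x, s) ∂μ) = P t := by
      rw [interval_integral_swap hK hμ (H := fun z => ∑ i, q i (z.1, t) * q i z) (by fun_prop)]
      refine integral_congr_ae (Eventually.of_forall fun x => ?_)
      simp only [hQ]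
      rw [intervalIntegral.integral_finsetSum fun i _ =>
        Continuous.intervalIntegrable (by have := cq i; fun_prop) _ _]
      simp only [intervalIntegral.integral_const_mul]
    rw [intervalIntegral.integral_add (Continuous.intervalIntegrable (by fun_prop) _ _)
        (Continuous.intervalIntegrable (by fun_prop) _ _),
      intervalIntegral.integral_add (Continuous.intervalIntegrable (by fun_prop) _ _)
        (Continuous.intervalIntegrable (by fun_prop) _ _),
      intervalIntegral.integral_sub (Continuous.intervalIntegrable (by fun_prop) _ _)
        (Continuous.intervalIntegrable (by fun_prop) _ _), h4,
      intervalIntegral.integral_const, intervalIntegral.integral_const_mul,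
      intervalIntegral.integral_const_mul, intervalIntegral.integral_const_mul, sub_zero,
      smul_eq_mul] at h3
    have h5 : t * (M * a t) ≤ T * (M * a t) :=
      mul_le_mul_of_nonneg_right ht.2.le (mul_nonneg hM (ha0 t))
    have h6 := mul_le_mul_of_nonneg_left (hρT t ht) (hn0 t)
    linarith
  -- For each x and i the time integral is half the square of ∫_0^T q_i.
  have hP0 : 0 ≤ ∫ t in (0 : ℝ)..T, P t := by
    rw [interval_integral_swap hK hμ cQ]
    refine integral_nonneg fun x => ?_
    simp only [hQ, Pi.zero_apply]
    rw [intervalIntegral.integral_finsetSum]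
    · refine Finset.sum_nonneg fun i _ => ?_
      have := cq i
      rw [integral_mul_primitive (φ := fun t => q i (x, t)) (by fun_prop)]
      positivity
    · intro i _
      have := cq i
      have c1 : Continuous fun t => q i (x, t) := by fun_prop
      exact (c1.mul (intervalIntegral.continuous_primitive
        (fun a b => c1.intervalIntegrable a b) 0)).intervalIntegrable _ _
  have hint : ∫ t in (0 : ℝ)..T, y t ≤ ∫ t in (0 : ℝ)..T, (n t * n 0 + T * (M * a t) - P t
      + n t * (∫ s in (0 : ℝ)..T, ρ s) + Cf * (n t * J t)) :=
    intervalIntegral.integral_mono_on_of_le_Ioo hT.le (cy.intervalIntegrable _ _)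
      (Continuous.intervalIntegrable (by fun_prop) _ _) hpt
  rw [intervalIntegral.integral_add (Continuous.intervalIntegrable (by fun_prop) _ _)
      (Continuous.intervalIntegrable (by fun_prop) _ _),
    intervalIntegral.integral_add (Continuous.intervalIntegrable (by fun_prop) _ _)
      (Continuous.intervalIntegrable (by fun_prop) _ _),
    intervalIntegral.integral_sub (Continuous.intervalIntegrable (by fun_prop) _ _)
      (Continuous.intervalIntegrable (by fun_prop) _ _),
    intervalIntegral.integral_add (Continuous.intervalIntegrable (by fun_prop) _ _)
      (Continuous.intervalIntegrable (by fun_prop) _ _),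
    intervalIntegral.integral_mul_const, intervalIntegral.integral_mul_const,
    intervalIntegral.integral_const_mul, intervalIntegral.integral_const_mul,
    intervalIntegral.integral_const_mul, integral_mul_primitive cn T] at hint
  have hsq : ∀ t, n t ^ 2 = y t := fun t => Real.sq_sqrt (hy0 t)
  have hnT : ∫ t in (0 : ℝ)..T, n t ≤ √T * √(∫ t in (0 : ℝ)..T, y t) := by
    have := intervalIntegral_le_sqrt hT.le cn
    simpa only [hsq] using this
  have hnT0 : 0 ≤ ∫ t in (0 : ℝ)..T, n t :=
    intervalIntegral.integral_nonneg hT.le fun t _ => hn0 t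
  have hρT' : ∫ t in (0 : ℝ)..T, ρ t ≤ √T * √(∫ t in (0 : ℝ)..T, (∫ x, R (x, t) ^ 2 ∂μ)) := by
    have h1 := intervalIntegral_le_sqrt hT.le cρ
    have h2 : ∀ t, ρ t ^ 2 = ∫ x, R (x, t) ^ 2 ∂μ := fun t =>
      Real.sq_sqrt (integral_nonneg fun x => sq_nonneg _)
    simpa only [h2] using h1
  have haT := hS.integral_abs_le hK hν hT.le
  have hTT : √T * √T = T := Real.mul_self_sqrt hT.le
  have hY0 : 0 ≤ ∫ t in (0 : ℝ)..T, y t :=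
    intervalIntegral.integral_nonneg hT.le fun t _ => hy0 t
  have e1 : (∫ t in (0 : ℝ)..T, n t) * n 0 ≤ √T * √(∫ t in (0 : ℝ)..T, y t) * n 0 :=
    mul_le_mul_of_nonneg_right hnT (hn0 0)
  have e2 : T * (M * ∫ t in (0 : ℝ)..T, a t) ≤ T * (M * (√(ν.real univ) * √T *
      √(∫ t in (0 : ℝ)..T, (∫ x, w (x, t) ^ 2 ∂ν)))) := by gcongr
  have e3 : (∫ t in (0 : ℝ)..T, n t) * (∫ t in (0 : ℝ)..T, ρ t) ≤
      (√T * √(∫ t in (0 : ℝ)..T, y t)) *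
        (√T * √(∫ t in (0 : ℝ)..T, (∫ x, R (x, t) ^ 2 ∂μ))) := by
    refine mul_le_mul hnT hρT' ?_ (by positivity)
    exact intervalIntegral.integral_nonneg hT.le fun t _ => Real.sqrt_nonneg _
  have e3' : (√T * √(∫ t in (0 : ℝ)..T, y t)) *
        (√T * √(∫ t in (0 : ℝ)..T, (∫ x, R (x, t) ^ 2 ∂μ))) =
      T * √(∫ t in (0 : ℝ)..T, (∫ x, R (x, t) ^ 2 ∂μ)) * √(∫ t in (0 : ℝ)..T, y t) := by
    rw [mul_mul_mul_comm, hTT]; ring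
  have e4 : (∫ t in (0 : ℝ)..T, n t) ^ 2 ≤ T * ∫ t in (0 : ℝ)..T, y t := by
    calc (∫ t in (0 : ℝ)..T, n t) ^ 2 ≤ (√T * √(∫ t in (0 : ℝ)..T, y t)) ^ 2 := by gcongr
      _ = _ := by rw [mul_pow, Real.sq_sqrt hT.le, Real.sq_sqrt hY0]
  have e5 := mul_le_mul_of_nonneg_left e4 hCf
  linarith

/-- The classical energy estimate with s = t, where the dissipation is a sum of squares and is
dropped. The factor 2 on the boundary term comes from differentiating w². -/
theorem energy_le_of_gronwall [SecondCountableTopology X] [IsFiniteMeasure μ]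
    [IsFiniteMeasure ν] (hS : EnergySystem μ ν T M Cf w p l R q) (hK : IsCompact K)
    (hμ : μ Kᶜ = 0) (hν : ν Kᶜ = 0) (hT : 0 < T) (hM : 0 ≤ M) (hCf : 0 ≤ Cf) :
    ∫ t in (0 : ℝ)..T, (∫ x, w (x, t) ^ 2 ∂μ) ≤
      ((∫ x, w (x, 0) ^ 2 ∂μ) + (∫ t in (0 : ℝ)..T, (∫ x, R (x, t) ^ 2 ∂μ))
        + 2 * (M * (√(ν.real univ) * √T * √(∫ t in (0 : ℝ)..T, (∫ x, w (x, t) ^ 2 ∂ν)))))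
      * (T * ((Real.exp ((1 + 2 * Cf) * T) - 1) / ((1 + 2 * Cf) * T))) := by
  have cw := hS.continuous_w
  have cp := hS.continuous_p
  have cR := hS.continuous_R
  have int : ∀ {h : X → ℝ}, Continuous h → Integrable h μ := integrable_of_continuous hK hμ
  set y : ℝ → ℝ := fun t => ∫ x, w (x, t) ^ 2 ∂μ with hy
  set b : ℝ → ℝ := fun t => ∫ x, R (x, t) ^ 2 ∂μ with hb
  set a : ℝ → ℝ := fun t => ∫ x, |w (x, t)| ∂ν with ha
  have cy : Continuous y := continuous_integral_slice hK hμ (H := fun z => w z ^ 2) (by fun_prop)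
  have cb : Continuous b := continuous_integral_slice hK hμ (H := fun z => R z ^ 2) (by fun_prop)
  have ca : Continuous a := continuous_integral_slice hK hν (H := fun z => |w z|) (by fun_prop)
  have hy0 : ∀ t, 0 ≤ y t := fun t => integral_nonneg fun x => sq_nonneg _
  have hb0 : ∀ t, 0 ≤ b t := fun t => integral_nonneg fun x => sq_nonneg _
  have ha0 : ∀ t, 0 ≤ a t := fun t => integral_nonneg fun x => abs_nonneg _
  set C := y 0 + ∫ t in (0 : ℝ)..T, b t with hC
  set L := 1 + 2 * Cf with hL
  have hL0 : 0 < L := by positivity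
  have haT := hS.integral_abs_le hK hν hT.le
  set G := M * (√(ν.real univ) * √T * √(∫ t in (0 : ℝ)..T, (∫ x, w (x, t) ^ 2 ∂ν))) with hG
  have hpt : ∀ t ∈ Icc 0 T, y t ≤ L * (∫ s in (0 : ℝ)..t, y s) + (C + 2 * G) := by
    intro t ht
    have h1 : y t = y 0 + ∫ s in (0 : ℝ)..t, 2 * (∫ x, w (x, s) * p (x, s) ∂μ) := by
      rw [intervalIntegral.integral_const_mul,
        interval_integral_swap hK hμ (H := fun z => w z * p z) (by fun_prop),
        ← integral_const_mul, ← integral_add (int (by fun_prop)) (int ?_)]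
      · refine integral_congr_ae ?_
        filter_upwards [hS.eq_add_integral] with x hx
        -- `w` coincides with this primitive only on [0, T], but the primitive is differentiable
        -- everywhere, so the fundamental theorem applies to its square.
        set W : ℝ → ℝ := fun t => w (x, 0) + ∫ s in (0 : ℝ)..t, p (x, s) with hW
        have cpx : Continuous fun s => p (x, s) := by fun_prop
        have hWd : ∀ t, HasDerivAt W (p (x, t)) t := fun t =>
          ((cpx.integral_hasStrictDerivAt 0 t).hasDerivAt).const_add _
        have cW : Continuous W := continuous_iff_continuousAt.2 fun t => (hWd t).continuousAt
        have hW2 : ∀ t, HasDerivAt (fun t => W t ^ 2) (2 * (W t * p (x, t))) t := fun t =>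
          ((hWd t).pow 2).congr_deriv (by push_cast; ring)
        have h2 := intervalIntegral.integral_eq_sub_of_hasDerivAt (a := 0) (b := t)
          (fun t _ => hW2 t) (Continuous.intervalIntegrable (by fun_prop) _ _)
        have h3 : ∫ s in (0 : ℝ)..t, w (x, s) * p (x, s) =
            ∫ s in (0 : ℝ)..t, W s * p (x, s) := by
          refine intervalIntegral.integral_congr fun s hs => ?_
          rw [uIcc_of_le ht.1] at hs
          simp only [hW, hx s ⟨hs.1, hs.2.trans ht.2⟩]
        rw [intervalIntegral.integral_const_mul] at h2
        rw [h3, h2, hx t ht]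
        simp [hW]
      · exact continuous_const.mul
          (intervalIntegral.continuous_parametric_intervalIntegral_of_continuous'
            (f := fun x s => w (x, s) * p (x, s)) (by fun_prop) 0 t)
    have h2 : ∫ s in (0 : ℝ)..t, 2 * (∫ x, w (x, s) * p (x, s) ∂μ) ≤
        ∫ s in (0 : ℝ)..t, (2 * (M * a s) + b s + L * y s) := by
      refine intervalIntegral.integral_mono_on_of_le_Ioo ht.1
        (Continuous.intervalIntegrable (continuous_const.mul (continuous_integral_slice hK hμ
          (H := fun z => w z * p z) (by fun_prop))) _ _)
        (Continuous.intervalIntegrable (by fun_prop) _ _) fun s hs => ?_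
      have hsT : s ∈ Ioo 0 T := ⟨hs.1, hs.2.trans_le ht.2⟩
      have h3 := hS.integral_mul_le hK hμ hCf hsT hsT
      have h4 : 0 ≤ ∫ x, ∑ i, q i (x, s) * q i (x, s) ∂μ :=
        integral_nonneg fun x => Finset.sum_nonneg fun i _ => mul_self_nonneg _
      have h5 : √(y s) * √(y s) = y s := Real.mul_self_sqrt (hy0 s)
      have h6 : 2 * (√(y s) * √(b s)) ≤ y s + b s := by
        nlinarith [sq_nonneg (√(y s) - √(b s)), Real.sq_sqrt (hy0 s), Real.sq_sqrt (hb0 s)]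
      change _ ≤ M * a s - _ + √(y s) * √(b s) + Cf * (√(y s) * √(y s)) at h3
      rw [h5] at h3
      rw [hL]
      linarith
    rw [intervalIntegral.integral_add (Continuous.intervalIntegrable (by fun_prop) _ _)
        (Continuous.intervalIntegrable (by fun_prop) _ _),
      intervalIntegral.integral_add (Continuous.intervalIntegrable (by fun_prop) _ _)
        (Continuous.intervalIntegrable (by fun_prop) _ _),
      intervalIntegral.integral_const_mul, intervalIntegral.integral_const_mul,
      intervalIntegral.integral_const_mul, intervalIntegral.integral_const_mul] at h2
    have h7 : ∫ s in (0 : ℝ)..t, a s ≤ ∫ s in (0 : ℝ)..T, a s :=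
      intervalIntegral.integral_mono_interval le_rfl ht.1 ht.2
        (Eventually.of_forall fun s => ha0 s) (ca.intervalIntegrable _ _)
    have h8 : ∫ s in (0 : ℝ)..t, b s ≤ ∫ s in (0 : ℝ)..T, b s :=
      intervalIntegral.integral_mono_interval le_rfl ht.1 ht.2
        (Eventually.of_forall fun s => hb0 s) (cb.intervalIntegrable _ _)
    have h9 : M * ∫ s in (0 : ℝ)..t, a s ≤ G :=
      mul_le_mul_of_nonneg_left (h7.trans haT) hM
    rw [intervalIntegral.integral_const_mul] at h1
    linarith
  have hYd : ∀ t, HasDerivAt (fun t => ∫ s in (0 : ℝ)..t, y s) (y t) t := fun t =>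
    (cy.integral_hasStrictDerivAt 0 t).hasDerivAt
  -- Gronwall is applied to Y(t) = ∫_0^t y, which starts from 0 and satisfies Y' ≤ L Y + C + 2G; no
  -- derivative of `y` is needed.
  have hgr := norm_le_gronwallBound_of_norm_deriv_right_le (a := 0) (b := T) (δ := 0) (K := L)
    (ε := C + 2 * G) (f := fun t => ∫ s in (0 : ℝ)..t, y s) (f' := y)
    (fun t _ => (hYd t).continuousAt.continuousWithinAt) (fun t _ => (hYd t).hasDerivWithinAt)
    (by simp) (fun t ht => by
      rw [Real.norm_of_nonneg (hy0 t), Real.norm_of_nonneg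
        (intervalIntegral.integral_nonneg ht.1 fun s _ => hy0 s)]
      exact hpt t ⟨ht.1, ht.2.le⟩) T ⟨hT.le, le_rfl⟩
  rw [gronwallBound_of_K_ne_0 hL0.ne', Real.norm_of_nonneg
    (intervalIntegral.integral_nonneg hT.le fun s _ => hy0 s)] at hgr
  refine hgr.trans_eq ?_
  rw [sub_zero]
  field_simp
  ring_nf

/-- The stability estimate for an energy system. -/
theorem sqrt_energy_le [SecondCountableTopology X] [IsFiniteMeasure μ]
    [IsFiniteMeasure ν] (hS : EnergySystem μ ν T M Cf w p l R q) (hK : IsCompact K)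
    (hμ : μ Kᶜ = 0) (hν : ν Kᶜ = 0) (hT : 0 < T) (hM : 0 ≤ M) (hCf : 0 ≤ Cf) :
    √(∫ t in (0 : ℝ)..T, (∫ x, w (x, t) ^ 2 ∂μ)) ≤
      const1 T Cf * (√(∫ x, w (x, 0) ^ 2 ∂μ) + √(∫ t in (0 : ℝ)..T, (∫ x, R (x, t) ^ 2 ∂μ))
        + √(M * (√(ν.real univ) * √T * √(∫ t in (0 : ℝ)..T, (∫ x, w (x, t) ^ 2 ∂ν))))) := by
  have h1 := hS.energy_le_of_multiplier hK hμ hν hT hM hCf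
  have h2 := hS.energy_le_of_gronwall hK hμ hν hT hM hCf
  have hY : 0 ≤ ∫ t in (0 : ℝ)..T, (∫ x, w (x, t) ^ 2 ∂μ) :=
    intervalIntegral.integral_nonneg hT.le fun t _ => integral_nonneg fun x => sq_nonneg _
  have hA : 0 ≤ ∫ x, w (x, 0) ^ 2 ∂μ := integral_nonneg fun x => sq_nonneg _
  have hB : 0 ≤ ∫ t in (0 : ℝ)..T, (∫ x, R (x, t) ^ 2 ∂μ) :=
    intervalIntegral.integral_nonneg hT.le fun t _ => integral_nonneg fun x => sq_nonneg _
  have hG : 0 ≤ M * (√(ν.real univ) * √T * √(∫ t in (0 : ℝ)..T, (∫ x, w (x, t) ^ 2 ∂ν))) := by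
    positivity
  have hc := sqrt_le_const1 hT hCf
  generalize (∫ t in (0 : ℝ)..T, (∫ x, w (x, t) ^ 2 ∂μ)) = Y at *
  generalize (∫ x, w (x, 0) ^ 2 ∂μ) = A at *
  generalize (∫ t in (0 : ℝ)..T, (∫ x, R (x, t) ^ 2 ∂μ)) = B at *
  generalize (M * (√(ν.real univ) * √T * √(∫ t in (0 : ℝ)..T, (∫ x, w (x, t) ^ 2 ∂ν)))) = G at *
  have hc0 : 0 ≤ const1 T Cf := Real.sqrt_nonneg _
  have sA := Real.sq_sqrt hA
  have sB := Real.sq_sqrt hB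
  have sG := Real.sq_sqrt hG
  have sY := Real.sq_sqrt hY
  have nA := Real.sqrt_nonneg A
  have nB := Real.sqrt_nonneg B
  have nG := Real.sqrt_nonneg G
  have nY := Real.sqrt_nonneg Y
  -- The threshold 1/2 serves both sides: below it 1 - Cf T / 2 stays at least 3/4, above it (1 + 2
  -- Cf) T exceeds 1.
  rcases le_or_gt (Cf * T) (1 / 2) with hsmall | hlarge
  · obtain ⟨k1, k2⟩ := const1_ge_of_small hT hCf hsmall
    by_contra! hlt
    set c := const1 T Cf
    set κ := 1 - Cf * T / 2 with hκ
    have hκ0 : 0 < κ := by rw [hκ]; linarith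
    have hYpos : 0 < √Y := lt_of_le_of_lt (by positivity) hlt
    have h3 : κ * √Y ^ 2 ≤ (√T * √A + T * √B) * √Y + T * G := by rw [sY, hκ]; linarith
    have h4 : (√T * √A + T * √B) * √Y ≤ κ * c * (√A + √B) * √Y := by
      have e1 := mul_le_mul_of_nonneg_right k1 nA
      have e2 := mul_le_mul_of_nonneg_right k2 nB
      refine mul_le_mul_of_nonneg_right ?_ nY
      linarith
    have h5 : T * G ≤ κ * c * √G * √Y := by
      have e1 : T * G = (√T * √G) * (√T * √G) := by
        nth_rewrite 1 [← Real.mul_self_sqrt hT.le, ← sG]; ring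
      -- The negated conclusion is itself used here: √T √G ≤ C_1 √G < √Y. One of the two factors √T
      -- √G of T G is thus traded for √Y, and the whole bound becomes linear in √Y.
      have e2 : √T * √G ≤ √Y := by
        have := mul_le_mul_of_nonneg_right hc nG
        have e3 : 0 ≤ c * (√A + √B) := by positivity
        linarith
      rw [e1]
      exact mul_le_mul (mul_le_mul_of_nonneg_right k1 nG) e2 (by positivity) (by positivity)
    have h6 : κ * √Y * (c * (√A + √B + √G)) < κ * √Y * √Y :=
      mul_lt_mul_of_pos_left hlt (by positivity)
    nlinarith
  · have k := const1_le_of_large hT (by linarith : 1 ≤ 2 * (Cf * T))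
    refine Real.sqrt_le_iff.2 ⟨by positivity, ?_⟩
    rw [mul_pow]
    set E := T * ((Real.exp ((1 + 2 * Cf) * T) - 1) / ((1 + 2 * Cf) * T))
    have hE : 0 ≤ E := by
      have : 0 ≤ Real.exp ((1 + 2 * Cf) * T) - 1 := by
        have := Real.one_le_exp (by positivity : 0 ≤ (1 + 2 * Cf) * T)
        linarith
      positivity
    have e1 : A + B + 2 * G ≤ 2 * (√A + √B + √G) ^ 2 := by
      have : 0 ≤ √A * √B + √A * √G + √B * √G := by positivity
      nlinarith
    calc Y ≤ (A + B + 2 * G) * E := h2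
      _ ≤ 2 * (√A + √B + √G) ^ 2 * E := by gcongr
      _ = (2 * E) * (√A + √B + √G) ^ 2 := by ring
      _ ≤ _ := by gcongr

end EnergySystem

/-! ### Calculus on the closed cylinder and the stability estimate -/

section Cylinder

variable {d k : ℕ} {D : Set (Pt d)} {T : ℝ}

theorem isCompact_cyl (hDb : Bornology.IsBounded D) : IsCompact (cyl D T) :=
  hDb.isCompact_closure.prod isCompact_Icc

theorem HasCkBoundary.uniqueDiffOn_cyl (hk : 1 ≤ k) (hDo : IsOpen D) (hDk : HasCkBoundary k D)
    (hT : 0 < T) : UniqueDiffOn ℝ (cyl D T) :=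
  (hDk.uniqueDiffOn_closure hk hDo).prod (uniqueDiffOn_Icc hT)

theorem lateral_subset_cyl : lateral D T ⊆ cyl D T :=
  prod_mono frontier_subset_closure le_rfl

theorem cyl_mem_nhds (hDo : IsOpen D) {x : Pt d} (hx : x ∈ D) {t : ℝ} (ht : t ∈ Ioo 0 T) :
    cyl D T ∈ 𝓝 (x, t) :=
  prod_mem_nhds (mem_of_superset (hDo.mem_nhds hx) subset_closure) (Icc_mem_nhds ht.1 ht.2)

theorem exists_continuous_extension {Y : Type*} [TopologicalSpace Y] [NormalSpace Y] {S : Set Y}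
    (hS : IsClosed S) {h : Y → ℝ} (hh : ContinuousOn h S) :
    ∃ H : Y → ℝ, Continuous H ∧ EqOn H h S := by
  obtain ⟨g, hg⟩ := ContinuousMap.exists_restrict_eq hS ⟨S.domRestrict h, hh.domRestrict⟩
  exact ⟨g, g.continuous, fun y hy => congr($hg ⟨y, hy⟩)⟩

theorem contDiffOn_slice {n : WithTop ℕ∞} {G : Type*} [NormedAddCommGroup G] [NormedSpace ℝ G]
    {g : Pt d × ℝ → G} (hg : ContDiffOn ℝ n g (cyl D T)) {t : ℝ} (ht : t ∈ Icc 0 T) :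
    ContDiffOn ℝ n (fun x => g (x, t)) (closure D) :=
  hg.comp (contDiff_id.prodMk contDiff_const).contDiffOn fun _ hx => ⟨hx, ht⟩

section Interior

variable {G : Type*} [NormedAddCommGroup G] [NormedSpace ℝ G] {g : Pt d × ℝ → G}

theorem hasFDerivAt_of_contDiffOn_cyl (hDo : IsOpen D) (hg : ContDiffOn ℝ 1 g (cyl D T))
    {x : Pt d} (hx : x ∈ D) {t : ℝ} (ht : t ∈ Ioo 0 T) :
    HasFDerivAt g (fderivWithin ℝ g (cyl D T) (x, t)) (x, t) :=
  ((hg.differentiableOn one_ne_zero) (x, t)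
    (mem_of_mem_nhds (cyl_mem_nhds hDo hx ht))).hasFDerivWithinAt.hasFDerivAt
    (cyl_mem_nhds hDo hx ht)

theorem hasFDerivAt_slice (hDo : IsOpen D) (hg : ContDiffOn ℝ 1 g (cyl D T))
    {x : Pt d} (hx : x ∈ D) {t : ℝ} (ht : t ∈ Ioo 0 T) :
    HasFDerivAt (fun y => g (y, t))
      ((fderivWithin ℝ g (cyl D T) (x, t)).comp (ContinuousLinearMap.inl ℝ (Pt d) ℝ)) x :=
  (hasFDerivAt_of_contDiffOn_cyl hDo hg hx ht).comp x (hasFDerivAt_prodMk_left x t)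

theorem hasDerivAt_time (hDo : IsOpen D) (hg : ContDiffOn ℝ 1 g (cyl D T))
    {x : Pt d} (hx : x ∈ D) {t : ℝ} (ht : t ∈ Ioo 0 T) :
    HasDerivAt (fun s => g (x, s)) (fderivWithin ℝ g (cyl D T) (x, t) (0, 1)) t :=
  (hasFDerivAt_of_contDiffOn_cyl hDo hg hx ht).comp_hasDerivAt t
    ((hasDerivAt_const t x).prodMk (hasDerivAt_id t))

end Interior

/-- The spatial partial derivative, extended continuously to the closed cylinder. -/
noncomputable def gradX (D : Set (Pt d)) (T : ℝ) (w : Pt d × ℝ → ℝ) (i : Fin d)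
    (z : Pt d × ℝ) : ℝ :=
  fderivWithin ℝ w (cyl D T) z (EuclideanSpace.single i 1, 0)

/-- The spatial Laplacian, extended continuously to the closed cylinder. -/
noncomputable def lapX (D : Set (Pt d)) (T : ℝ) (w : Pt d × ℝ → ℝ) (z : Pt d × ℝ) : ℝ :=
  ∑ i, gradX D T (gradX D T w i) i z

variable {w : Pt d × ℝ → ℝ}

theorem contDiffOn_gradX (hU : UniqueDiffOn ℝ (cyl D T)) {m n : WithTop ℕ∞} (hmn : m + 1 ≤ n)
    (hw : ContDiffOn ℝ n w (cyl D T)) (i : Fin d) : ContDiffOn ℝ m (gradX D T w i) (cyl D T) :=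
  (hw.fderivWithin hU hmn).clm_apply contDiffOn_const

theorem continuousOn_lapX (hU : UniqueDiffOn ℝ (cyl D T)) (hw : ContDiffOn ℝ 2 w (cyl D T)) :
    ContinuousOn (lapX D T w) (cyl D T) := by
  refine continuousOn_finsetSum _ fun i _ => ?_
  exact (contDiffOn_gradX hU (m := 0) (n := 1) (by norm_num)
    (contDiffOn_gradX hU (m := 1) (n := 2) (by norm_num) hw i) i).continuousOn

/-- The cylinder is a neighbourhood of each of its interior points, so derivatives within it are
ordinary derivatives there. -/
theorem laplacian_eq_lapX (hDo : IsOpen D) (hU : UniqueDiffOn ℝ (cyl D T))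
    (hw : ContDiffOn ℝ 2 w (cyl D T)) {x : Pt d} (hx : x ∈ D) {t : ℝ} (ht : t ∈ Ioo 0 T) :
    Laplacian.laplacian (fun y => w (y, t)) x = lapX D T w (x, t) := by
  have hw1 : ContDiffOn ℝ 1 w (cyl D T) := hw.of_le (by norm_num)
  have h2 : ContDiffAt ℝ 2 (fun y => w (y, t)) x :=
    (contDiffOn_slice hw ⟨ht.1.le, ht.2.le⟩ x (subset_closure hx)).contDiffAt
      (mem_of_superset (hDo.mem_nhds hx) subset_closure)
  have h3 : DifferentiableAt ℝ (fderiv ℝ fun y => w (y, t)) x :=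
    (h2.fderiv_right (m := 1) (by norm_num)).differentiableAt one_ne_zero
  rw [InnerProductSpace.laplacian_eq_iteratedFDeriv_orthonormalBasis _
    (EuclideanSpace.basisFun (Fin d) ℝ), lapX]
  refine Finset.sum_congr rfl fun i _ => ?_
  rw [iteratedFDeriv_two_apply]
  simp only [EuclideanSpace.basisFun_apply, Matrix.cons_val_zero, Matrix.cons_val_one]
  have hev : (fun y => fderiv ℝ (fun y => w (y, t)) y (EuclideanSpace.single i 1)) =ᶠ[𝓝 x]
      fun y => gradX D T w i (y, t) := by
    filter_upwards [hDo.mem_nhds hx] with y hy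
    rw [(hasFDerivAt_slice hDo hw1 hy ht).fderiv]
    rfl
  have h4 := h3.hasFDerivAt.clm_apply
    (hasFDerivAt_const (EuclideanSpace.single i (1 : ℝ) : Pt d) x)
  have h5 := (hasFDerivAt_slice hDo (contDiffOn_gradX hU (m := 1) (n := 2) (by norm_num) hw i)
    hx ht).congr_of_eventuallyEq hev
  have h6 := congr($(h4.unique h5) (EuclideanSpace.single i 1))
  simpa [gradX] using h6

/-- Evaluate the full derivative at (v, 0), with v the spatial gradient itself: the value is ‖v‖²,
and ‖(v, 0)‖ = ‖v‖ in the product norm. -/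
theorem norm_gradX_le (z : Pt d × ℝ) :
    ‖(WithLp.toLp 2 fun i => gradX D T w i z : Pt d)‖ ≤ ‖fderivWithin ℝ w (cyl D T) z‖ := by
  set L := fderivWithin ℝ w (cyl D T) z with hL
  set v : Pt d := WithLp.toLp 2 fun i => gradX D T w i z with hv
  have h1 : L (v, 0) = ‖v‖ ^ 2 := by
    have h2 : (v, (0 : ℝ)) = ∑ i, gradX D T w i z • ((EuclideanSpace.single i (1 : ℝ) : Pt d),
        (0 : ℝ)) := by
      ext j
      · simp [hv, Prod.fst_sum, Pi.single_apply]
      · simp [Prod.snd_sum]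
    rw [h2, map_sum, EuclideanSpace.norm_sq_eq]
    refine Finset.sum_congr rfl fun i _ => ?_
    rw [map_smul, smul_eq_mul, Real.norm_eq_abs, sq_abs, sq]
    rfl
  have h3 : ‖v‖ ^ 2 ≤ ‖L‖ * ‖v‖ := by
    rw [← h1]
    refine (le_abs_self _).trans ((L.le_opNorm _).trans ?_)
    simp [Prod.norm_def]
  rcases (norm_nonneg v).eq_or_lt with h | h
  · rw [← h]; exact norm_nonneg _
  · nlinarith

/-- Green's first identity as an inequality, for two time slices of a function. -/
theorem green_slices_le (hk : 1 ≤ k) (hDo : IsOpen D) (hDb : Bornology.IsBounded D)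
    (hDk : HasCkBoundary k D) (hT : 0 < T) (hw : ContDiffOn ℝ 2 w (cyl D T)) {M : ℝ}
    (hM : ∀ z ∈ lateral D T, ‖fderivWithin ℝ w (cyl D T) z‖ ≤ M) {t s : ℝ} (ht : t ∈ Ioo 0 T)
    (hs : s ∈ Ioo 0 T) :
    ∫ x in D, (w (x, t) * lapX D T w (x, s) + ∑ i, gradX D T w i (x, t) * gradX D T w i (x, s)) ≤
      M * ∫ x, |w (x, t)| ∂(surfaceMeasure D) := by
  have hU := hDk.uniqueDiffOn_cyl hk hDo hT
  have hfin := hDk.isFiniteMeasure_surfaceMeasure hk hDo hDb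
  have ht' : t ∈ Icc 0 T := ⟨ht.1.le, ht.2.le⟩
  have hs' : s ∈ Icc 0 T := ⟨hs.1.le, hs.2.le⟩
  have hw1 : ContDiffOn ℝ 1 w (cyl D T) := hw.of_le (by norm_num)
  have hg : ∀ i, ContDiffOn ℝ 1 (gradX D T w i) (cyl D T) := fun i =>
    contDiffOn_gradX hU (m := 1) (n := 2) (by norm_num) hw i
  -- The field w(t) ∇w(s), whose divergence is w(t) Δw(s) + ∇w(t) · ∇w(s).
  set F : Pt d → Pt d := fun x => w (x, t) • WithLp.toLp 2 fun i => gradX D T w i (x, s) with hF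
  have hFi : ∀ i x, F x i = w (x, t) * gradX D T w i (x, s) := fun i x => by simp [hF]
  have hFC : ContDiffOn ℝ 1 F (closure D) := by
    rw [contDiffOn_euclidean]
    intro i
    simp only [hFi]
    exact (contDiffOn_slice hw1 ht').mul (contDiffOn_slice (hg i) hs')
  have hdiv : ∀ x ∈ D, divg F x =
      w (x, t) * lapX D T w (x, s) + ∑ i, gradX D T w i (x, t) * gradX D T w i (x, s) := by
    intro x hx
    rw [lapX, Finset.mul_sum, ← Finset.sum_add_distrib, divg]
    refine Finset.sum_congr rfl fun i _ => ?_
    have h1 : DifferentiableAt ℝ F x :=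
      ((hFC.differentiableOn one_ne_zero) x (subset_closure hx)).differentiableAt
        (mem_of_superset (hDo.mem_nhds hx) subset_closure)
    have h2 := (EuclideanSpace.proj (𝕜 := ℝ) i).hasFDerivAt.comp x h1.hasFDerivAt
    have h3 : HasFDerivAt (fun x => w (x, t) * gradX D T w i (x, s)) _ x :=
      (hasFDerivAt_slice hDo hw1 hx ht).mul (hasFDerivAt_slice hDo (hg i) hx hs)
    have h4 : (EuclideanSpace.proj (𝕜 := ℝ) i) ∘ F = fun x => w (x, t) * gradX D T w i (x, s) :=
      funext fun x => hFi i x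
    rw [h4] at h2
    have h5 := congr($(h2.unique h3) (EuclideanSpace.single i 1))
    simp only [ContinuousLinearMap.comp_apply, add_apply,
      smul_apply, ContinuousLinearMap.inl_apply, smul_eq_mul] at h5
    refine Eq.trans ?_ (h5.trans ?_)
    · rfl
    · simp only [gradX]; ring
  rw [← setIntegral_congr_fun hDo.measurableSet hdiv]
  refine (le_abs_self _).trans ((abs_integral_divg_le hk hDo hDb hDk hFC).trans ?_)
  rw [← integral_const_mul]
  have hcw : ContinuousOn (fun x => w (x, t)) (frontier D) :=
    (contDiffOn_slice hw1 ht').continuousOn.mono frontier_subset_closure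
  refine setIntegral_mono_on (integrable_surfaceMeasure hDb
    (hFC.continuousOn.mono frontier_subset_closure).norm)
    (integrable_surfaceMeasure hDb (continuousOn_const.mul hcw.abs))
    isClosed_frontier.measurableSet fun x hx => ?_
  simp only [hF]
  rw [norm_smul, Real.norm_eq_abs, mul_comm]
  gcongr
  exact (norm_gradX_le _).trans (hM _ ⟨hx, hs'⟩)

/-- Stability of the semilinear heat equation with respect to the interior, initial and boundary
residuals. -/
theorem stability_estimate (hk : 1 ≤ k) (hDo : IsOpen D) (hDb : Bornology.IsBounded D)
    (hDk : HasCkBoundary k D) (hT : 0 < T) (hw : ContDiffOn ℝ 2 w (cyl D T))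
    {R : Pt d × ℝ → ℝ} (hR : ContinuousOn R (cyl D T)) {Cf : ℝ} (hCf : 0 ≤ Cf)
    (hreact : ∀ x ∈ D, ∀ t ∈ Ioo 0 T, |deriv (fun s => w (x, s)) t
      - Laplacian.laplacian (fun y => w (y, t)) x - R (x, t)| ≤ Cf * |w (x, t)|)
    {M : ℝ} (hM0 : 0 ≤ M) (hM : ∀ z ∈ lateral D T, ‖fderivWithin ℝ w (cyl D T) z‖ ≤ M) :
    √(∫ t in (0 : ℝ)..T, (∫ x in D, w (x, t) ^ 2)) ≤
      const1 T Cf * (√(∫ x in D, w (x, 0) ^ 2) + √(∫ t in (0 : ℝ)..T, (∫ x in D, R (x, t) ^ 2))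
        + √(M * (√((surfaceMeasure D).real univ) * √T *
          √(∫ t in (0 : ℝ)..T, (∫ x, w (x, t) ^ 2 ∂(surfaceMeasure D)))))) := by
  have hU := hDk.uniqueDiffOn_cyl hk hDo hT
  have hfin := hDk.isFiniteMeasure_surfaceMeasure hk hDo hDb
  have hDc : IsCompact (closure D) := hDb.isCompact_closure
  have hQc : IsClosed (cyl D T) := (isCompact_cyl hDb).isClosed
  have hvol : IsFiniteMeasure (volume.restrict D) :=
    isFiniteMeasure_restrict.2 ((measure_mono subset_closure).trans_lt hDc.measure_lt_top).ne
  have hw1 : ContDiffOn ℝ 1 w (cyl D T) := hw.of_le (by norm_num)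
  -- The data are continuous on the closed cylinder only. Tietze extensions make them globally
  -- continuous, and every integral involved sees only their values on the cylinder.
  obtain ⟨w', cw, ew⟩ := exists_continuous_extension hQc hw.continuousOn
  obtain ⟨p', cp, ep⟩ := exists_continuous_extension hQc
    (h := fun z => fderivWithin ℝ w (cyl D T) z (0, 1))
    ((hw1.continuousOn_fderivWithin hU le_rfl).clm_apply continuousOn_const)
  obtain ⟨l', cl, el⟩ := exists_continuous_extension hQc (continuousOn_lapX hU hw)
  obtain ⟨R', cR, eR⟩ := exists_continuous_extension hQc hR
  choose q' cq eq using fun i => exists_continuous_extension hQc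
    (contDiffOn_gradX hU (m := 1) (n := 2) (by norm_num) hw i).continuousOn
  have hin : ∀ {x t}, x ∈ D → t ∈ Icc 0 T → (x, t) ∈ cyl D T := fun hx ht =>
    ⟨subset_closure hx, ht⟩
  have hbd : ∀ {x t}, x ∈ frontier D → t ∈ Icc 0 T → (x, t) ∈ cyl D T := fun hx ht =>
    ⟨frontier_subset_closure hx, ht⟩
  have hIcc : ∀ {t}, t ∈ Ioo 0 T → t ∈ Icc 0 T := fun ht => ⟨ht.1.le, ht.2.le⟩
  have hμ : volume.restrict D (closure D)ᶜ = 0 := by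
    rw [Measure.restrict_apply isClosed_closure.measurableSet.compl,
      (disjoint_compl_left_iff_subset.2 subset_closure).inter_eq, measure_empty]
  have hS : EnergySystem (volume.restrict D) (surfaceMeasure D) T M Cf w' p' l' R' q' := by
    refine ⟨cw, cp, cl, cR, cq, ?_, ?_, ?_⟩
    · filter_upwards [ae_restrict_mem hDo.measurableSet] with x hx t ht
      have h1 : ContinuousOn (fun s => w' (x, s)) (Icc 0 t) := by fun_prop
      have h2 : ∀ s ∈ Ioo 0 t, HasDerivAt (fun s => w' (x, s)) (p' (x, s)) s := by
        intro s hs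
        have hsT : s ∈ Ioo 0 T := ⟨hs.1, hs.2.trans_le ht.2⟩
        rw [ep (hin hx (hIcc hsT))]
        refine (hasDerivAt_time hDo hw1 hx hsT).congr_of_eventuallyEq ?_
        filter_upwards [Ioo_mem_nhds hsT.1 hsT.2] with r hr using ew (hin hx (hIcc hr))
      rw [intervalIntegral.integral_eq_sub_of_hasDerivAt_of_le ht.1 h1 h2
        (Continuous.intervalIntegrable (by fun_prop) _ _)]
      ring
    · intro t ht s hs
      rw [← integral_add (integrable_of_continuous hDc hμ (by fun_prop))
        (integrable_of_continuous hDc hμ (by fun_prop))]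
      have h1 := green_slices_le hk hDo hDb hDk hT hw hM ht hs
      have h2 : ∫ x in D, (w' (x, t) * l' (x, s) + ∑ i, q' i (x, t) * q' i (x, s)) =
          ∫ x in D, (w (x, t) * lapX D T w (x, s)
            + ∑ i, gradX D T w i (x, t) * gradX D T w i (x, s)) := by
        refine setIntegral_congr_fun hDo.measurableSet fun x hx => ?_
        simp only [ew (hin hx (hIcc ht)), el (hin hx (hIcc hs)), eq _ (hin hx (hIcc ht)),
          eq _ (hin hx (hIcc hs))]
      have h3 : ∫ x, |w' (x, t)| ∂(surfaceMeasure D) = ∫ x, |w (x, t)| ∂(surfaceMeasure D) :=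
        setIntegral_congr_fun isClosed_frontier.measurableSet fun x hx => by
          simp only [ew (hbd hx (hIcc ht))]
      rw [h2, h3]
      exact h1
    · intro t ht
      filter_upwards [ae_restrict_mem hDo.measurableSet] with x hx
      have h1 := hreact x hx t ht
      rw [(hasDerivAt_time hDo hw1 hx ht).deriv, laplacian_eq_lapX hDo hU hw hx ht] at h1
      rwa [ep (hin hx (hIcc ht)), el (hin hx (hIcc ht)), eR (hin hx (hIcc ht)),
        ew (hin hx (hIcc ht))]
  have hν : surfaceMeasure D (closure D)ᶜ = 0 := by
    rw [surfaceMeasure, Measure.restrict_apply isClosed_closure.measurableSet.compl,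
      (disjoint_compl_left_iff_subset.2 frontier_subset_closure).inter_eq, measure_empty]
  have h := hS.sqrt_energy_le hDc hμ hν hT hM0 hCf
  have i1 : ∀ {g g' : Pt d × ℝ → ℝ}, EqOn g' g (cyl D T) → ∀ t ∈ Icc 0 T,
      ∫ x in D, g' (x, t) ^ 2 = ∫ x in D, g (x, t) ^ 2 := fun e t ht =>
    setIntegral_congr_fun hDo.measurableSet fun x hx => by simp only [e (hin hx ht)]
  have i2 : ∀ {g g' : Pt d × ℝ → ℝ}, EqOn g' g (cyl D T) →
      ∫ t in (0 : ℝ)..T, (∫ x in D, g' (x, t) ^ 2) = ∫ t in (0 : ℝ)..T, (∫ x in D, g (x, t) ^ 2) :=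
    fun e => intervalIntegral.integral_congr fun t ht => i1 e t (by rwa [uIcc_of_le hT.le] at ht)
  have i3 : ∫ t in (0 : ℝ)..T, (∫ x, w' (x, t) ^ 2 ∂(surfaceMeasure D)) =
      ∫ t in (0 : ℝ)..T, (∫ x, w (x, t) ^ 2 ∂(surfaceMeasure D)) := by
    refine intervalIntegral.integral_congr fun t ht => ?_
    rw [uIcc_of_le hT.le] at ht
    exact setIntegral_congr_fun isClosed_frontier.measurableSet fun x hx => by
      simp only [ew (hbd hx ht)]
  rwa [i2 ew, i2 eR, i3, i1 ew 0 ⟨le_rfl, hT.le⟩] at h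

end Cylinder

/-! ### Smoothness of the network -/

section Network

theorem Net.contDiff_eval {k : WithTop ℕ∞} {σ : ℝ → ℝ} (hσ : ContDiff ℝ k σ) :
    ∀ {n m : ℕ} (θ : Net n m), ContDiff ℝ k (θ.eval σ)
  | _, _, .output W b => (Matrix.mulVecLin W).toContinuousLinearMap.contDiff.add contDiff_const
  | _, _, .hidden W b rest => by
    refine (Net.contDiff_eval hσ rest).comp (contDiff_pi.2 fun i => hσ.comp ?_)
    exact contDiff_pi.1
      ((Matrix.mulVecLin W).toContinuousLinearMap.contDiff.add (contDiff_const (c := b))) i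

theorem Net.contDiff_fn {d : ℕ} {k : WithTop ℕ∞} {σ : ℝ → ℝ} (hσ : ContDiff ℝ k σ)
    (θ : Net (d + 1) 1) : ContDiff ℝ k (θ.fn σ) := by
  have h1 : ContDiff ℝ k fun z : Pt d × ℝ =>
      (Fin.snoc (α := fun _ => ℝ) (fun i => z.1 i) z.2 : Fin (d + 1) → ℝ) := by
    refine contDiff_pi.2 fun i => ?_
    refine Fin.lastCases ?_ (fun j => ?_) i
    · simpa using contDiff_snd
    · simp only [Fin.snoc_castSucc]
      exact (EuclideanSpace.proj (𝕜 := ℝ) j).contDiff.comp contDiff_fst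
  exact contDiff_pi.1 ((θ.contDiff_eval hσ).comp h1) 0

end Network

/-! ### Smoothness of the interior residual -/

section Residual

variable {d : ℕ} {v : Pt d × ℝ → ℝ}

theorem laplacian_slice_eq (hv : ContDiff ℝ 2 v) (z : Pt d × ℝ) :
    Laplacian.laplacian (fun y => v (y, z.2)) z.1 =
      ∑ i, fderiv ℝ (fun z => fderiv ℝ v z (EuclideanSpace.single i 1, 0)) z
        (EuclideanSpace.single i 1, 0) := by
  have hslice : ∀ {g : Pt d × ℝ → ℝ}, ContDiff ℝ 1 g → ∀ x, HasFDerivAt (fun y => g (y, z.2))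
      ((fderiv ℝ g (x, z.2)).comp (ContinuousLinearMap.inl ℝ (Pt d) ℝ)) x := fun hg x =>
    ((hg.differentiable one_ne_zero) (x, z.2)).hasFDerivAt.comp x (hasFDerivAt_prodMk_left x z.2)
  have h2 : ContDiff ℝ 2 fun y => v (y, z.2) := hv.comp (contDiff_id.prodMk contDiff_const)
  have h3 : DifferentiableAt ℝ (fderiv ℝ fun y => v (y, z.2)) z.1 :=
    (h2.fderiv_right (m := 1) (by norm_num)).differentiable one_ne_zero z.1
  rw [InnerProductSpace.laplacian_eq_iteratedFDeriv_orthonormalBasis _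
    (EuclideanSpace.basisFun (Fin d) ℝ)]
  refine Finset.sum_congr rfl fun i _ => ?_
  rw [iteratedFDeriv_two_apply]
  simp only [EuclideanSpace.basisFun_apply, Matrix.cons_val_zero, Matrix.cons_val_one]
  have he : (fun y => fderiv ℝ (fun y => v (y, z.2)) y (EuclideanSpace.single i 1)) =
      fun y => fderiv ℝ v (y, z.2) (EuclideanSpace.single i 1, 0) := by
    ext y
    rw [(hslice (hv.of_le (by norm_num)) y).fderiv]
    rfl
  have h4 := h3.hasFDerivAt.clm_apply
    (hasFDerivAt_const (EuclideanSpace.single i (1 : ℝ) : Pt d) z.1)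
  rw [he] at h4
  have hg : ContDiff ℝ 1 fun z => fderiv ℝ v z (EuclideanSpace.single i 1, 0) :=
    (hv.fderiv_right (m := 1) (by norm_num)).clm_apply contDiff_const
  have h6 := congr($(h4.unique (hslice hg z.1)) (EuclideanSpace.single i 1))
  simpa using h6

theorem contDiff_resInt {k : ℕ} (hk : 2 ≤ k) {f : ℝ → ℝ} (hf : ContDiff ℝ (k - 2 : ℕ) f)
    (hv : ContDiff ℝ k v) : ContDiff ℝ (k - 2 : ℕ) (resInt f v) := by
  -- Writing k = m + 2 removes the truncated subtraction; the Laplacian costs exactly these two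
  -- derivatives.
  obtain ⟨m, rfl⟩ := Nat.exists_eq_add_of_le' hk
  rw [Nat.add_sub_cancel] at hf ⊢
  have hv2 : ContDiff ℝ 2 v := hv.of_le (by exact_mod_cast hk)
  have hvm : ContDiff ℝ m v := hv.of_le (by exact_mod_cast Nat.le_add_right m 2)
  have hD : ContDiff ℝ (m + 1) (fderiv ℝ v) :=
    hv.fderiv_right (by push_cast; rw [add_assoc]; norm_num)
  have hDt : ∀ z : Pt d × ℝ, deriv (fun s => v (z.1, s)) z.2 = fderiv ℝ v z (0, 1) := fun z =>
    ((hv2.differentiable two_ne_zero z).hasFDerivAt.comp_hasDerivAt z.2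
      ((hasDerivAt_const z.2 z.1).prodMk (hasDerivAt_id z.2))).deriv
  unfold resInt
  simp only [hDt, laplacian_slice_eq hv2]
  refine ContDiff.sub (ContDiff.sub ?_ ?_) (hf.comp hvm)
  · exact (hD.of_le le_self_add).clm_apply contDiff_const
  · refine ContDiff.sum fun i _ => ?_
    exact ((hD.clm_apply contDiff_const).fderiv_right le_rfl).clm_apply contDiff_const

end Residual

/-! ### The C¹ norm bounds the derivative -/

section Norms

variable {V : Type*} [NormedAddCommGroup V] [NormedSpace ℝ V]

theorem ckNorm_nonneg (k : ℕ) (S A : Set V) (g : V → ℝ) : 0 ≤ ckNorm k S A g :=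
  Finset.sum_nonneg fun _ _ => Real.iSup_nonneg fun _ => norm_nonneg _

/-- Compactness of `S` bounds the family of derivatives; without a bound the real supremum would
take the default value 0. -/
theorem norm_fderivWithin_le_ckNorm {S A : Set V} (hS : IsCompact S) (hU : UniqueDiffOn ℝ S)
    (hA : A ⊆ S) {g : V → ℝ} (hg : ContDiffOn ℝ 1 g S) {z : V} (hz : z ∈ A) :
    ‖fderivWithin ℝ g S z‖ ≤ ckNorm 1 S A g := by
  have hcont := hg.continuousOn_iteratedFDerivWithin (m := 1) le_rfl hU
  obtain ⟨C, hC⟩ := hS.exists_bound_of_continuousOn hcont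
  have h1 : ‖iteratedFDerivWithin ℝ 1 g S z‖ ≤
      ⨆ z : A, ‖iteratedFDerivWithin ℝ 1 g S (z : V)‖ :=
    le_ciSup (f := fun z : A => ‖iteratedFDerivWithin ℝ 1 g S (z : V)‖)
      ⟨C, by rintro _ ⟨y, rfl⟩; exact hC y (hA y.2)⟩ ⟨z, hz⟩
  rw [norm_iteratedFDerivWithin_one g (hU z (hA hz))] at h1
  refine h1.trans ?_
  rw [ckNorm, Finset.sum_range_succ]
  refine le_add_of_nonneg_left (Finset.sum_nonneg fun _ _ => Real.iSup_nonneg fun _ =>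
    norm_nonneg _)

end Norms

/-! ### From integrals to training errors -/

section Quadrature

theorem sqrt_add_le (a : ℝ) {b : ℝ} (hb : 0 ≤ b) : √(a + b) ≤ √a + √b := by
  rcases le_total 0 a with ha | ha
  · refine Real.sqrt_le_iff.2 ⟨by positivity, ?_⟩
    nlinarith [Real.sq_sqrt ha, Real.sq_sqrt hb, mul_nonneg (Real.sqrt_nonneg a)
      (Real.sqrt_nonneg b)]
  · rw [Real.sqrt_eq_zero_of_nonpos ha, zero_add]
    exact Real.sqrt_le_sqrt (by linarith)

variable {Z : Type*} {N : ℕ} {I : (Z → ℝ) → ℝ} {F : (Z → ℝ) → Prop} {nrm : (Z → ℝ) → ℝ}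
  {y : Fin N → Z} {w : Fin N → ℝ} {C : ℝ → ℝ} {α : ℝ}

/-- The first bound serves the interior and initial residuals. The second, with one more square
root, serves the boundary residual, which enters stability through the square root of its L² norm;
hence the exponents 1/4. -/
theorem QuadBound.sqrt_integral_sq_le (hQ : QuadBound I F nrm y w C α) (hN : 1 ≤ N)
    {R : Z → ℝ} (hR : F fun z => R z ^ 2) :
    √(I fun z => R z ^ 2) ≤ trainErr y w R +
      C (nrm fun z => R z ^ 2) ^ (1 / 2 : ℝ) * (N : ℝ) ^ (-α / 2) ∧
    √√(I fun z => R z ^ 2) ≤ trainErr y w R ^ (1 / 2 : ℝ) +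
      C (nrm fun z => R z ^ 2) ^ (1 / 4 : ℝ) * (N : ℝ) ^ (-α / 4) := by
  have hN0 : (0 : ℝ) < N := by exact_mod_cast hN
  have h := hQ _ hR
  set c := C (nrm fun z => R z ^ 2)
  have hpow : (0 : ℝ) < (N : ℝ) ^ (-α) := Real.rpow_pos_of_pos hN0 _
  -- The quadrature constant bounds an absolute value, so it is nonnegative at this argument.
  have hc : 0 ≤ c := nonneg_of_mul_nonneg_left ((abs_nonneg _).trans h) hpow
  have hs : ∑ n, w n * |R (y n)| ^ 2 = ∑ n, w n * R (y n) ^ 2 := by simp only [sq_abs]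
  have h1 : I (fun z => R z ^ 2) ≤ ∑ n, w n * R (y n) ^ 2 + c * (N : ℝ) ^ (-α) := by
    linarith [(abs_le.1 h).2]
  have h2 : √(c * (N : ℝ) ^ (-α)) = c ^ (1 / 2 : ℝ) * (N : ℝ) ^ (-α / 2) := by
    rw [Real.sqrt_mul hc, Real.sqrt_eq_rpow, Real.sqrt_eq_rpow, ← Real.rpow_mul hN0.le]
    ring_nf
  have h3 : √(I fun z => R z ^ 2) ≤ trainErr y w R + c ^ (1 / 2 : ℝ) * (N : ℝ) ^ (-α / 2) := by
    rw [← h2, trainErr, hs]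
    exact (Real.sqrt_le_sqrt h1).trans (sqrt_add_le _ (by positivity))
  refine ⟨h3, (Real.sqrt_le_sqrt h3).trans ?_⟩
  have h4 : √(c ^ (1 / 2 : ℝ) * (N : ℝ) ^ (-α / 2)) =
      c ^ (1 / 4 : ℝ) * (N : ℝ) ^ (-α / 4) := by
    rw [Real.sqrt_mul (by positivity), Real.sqrt_eq_rpow, Real.sqrt_eq_rpow,
      ← Real.rpow_mul hN0.le, ← Real.rpow_mul hc]
    ring_nf
  rw [← h4, ← Real.sqrt_eq_rpow (trainErr y w R)]
  exact sqrt_add_le _ (by positivity)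

end Quadrature

end HeatPINN

/-! ### Assembly of the error estimate -/

theorem theorem3p1 {d k : ℕ} (hd : 1 ≤ d) (hk : 2 ≤ k)
    -- the domain and the time horizon
    (D : Set (HeatPINN.Pt d)) (hDo : IsOpen D) (hDc : IsConnected D)
    (hDb : Bornology.IsBounded D) (hDk : HeatPINN.HasCkBoundary k D)
    (T : ℝ) (hT : 0 < T)
    -- the globally Lipschitz nonlinearity
    (f : ℝ → ℝ) (Cf : ℝ) (hf : ∀ v w : ℝ, |f v - f w| ≤ Cf * |v - w|)
    (hfk : ContDiff ℝ (k - 2 : ℕ) f)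
    -- the initial datum and the classical solution
    (ubar : HeatPINN.Pt d → ℝ) (hubar : ContDiffOn ℝ k ubar (closure D))
    (u : HeatPINN.Pt d × ℝ → ℝ) (huk : ContDiffOn ℝ k u (HeatPINN.cyl D T))
    (hu : HeatPINN.SolvesHeat D T f ubar u)
    -- the neural network, with any parameters
    (σ : ℝ → ℝ) (hσ : ContDiff ℝ k σ) (θ : HeatPINN.Net (d + 1) 1)
    -- initial training points and quadrature
    (Ntb : ℕ) (hNtb : 1 ≤ Ntb) (ytb : Fin Ntb → HeatPINN.Pt d) (wtb : Fin Ntb → ℝ)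
    (hytb : ∀ n, ytb n ∈ D) (hwtb : ∀ n, 0 ≤ wtb n)
    (Ctb : ℝ → ℝ) (αtb : ℝ) (hαtb : 0 < αtb)
    (hQtb : HeatPINN.QuadBound (fun g => ∫ x in D, g x)
      (fun g => ContDiffOn ℝ k g (closure D))
      (HeatPINN.ckNorm k (closure D) (closure D)) ytb wtb Ctb αtb)
    -- spatial boundary training points and quadrature
    (Nsb : ℕ) (hNsb : 1 ≤ Nsb) (ysb : Fin Nsb → HeatPINN.Pt d × ℝ) (wsb : Fin Nsb → ℝ)
    (hysb : ∀ n, ysb n ∈ HeatPINN.lateral D T) (hwsb : ∀ n, 0 ≤ wsb n)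
    (Csb : ℝ → ℝ) (αsb : ℝ) (hαsb : 0 < αsb)
    (hQsb : HeatPINN.QuadBound
      (fun g => ∫ t in (0 : ℝ)..T, ∫ x, g (x, t) ∂(HeatPINN.surfaceMeasure D))
      (HeatPINN.IsCkOnSurface k (HeatPINN.lateral D T))
      (HeatPINN.surfaceCkNorm k (HeatPINN.lateral D T)) ysb wsb Csb αsb)
    -- interior training points and quadrature
    (Nint : ℕ) (hNint : 1 ≤ Nint) (yint : Fin Nint → HeatPINN.Pt d × ℝ) (wint : Fin Nint → ℝ)
    (hyint : ∀ n, yint n ∈ D ×ˢ Set.Ioo 0 T) (hwint : ∀ n, 0 ≤ wint n)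
    (Cint : ℝ → ℝ) (αint : ℝ) (hαint : 0 < αint)
    (hQint : HeatPINN.QuadBound (fun g => ∫ t in (0 : ℝ)..T, ∫ x in D, g (x, t))
      (fun g => ContDiffOn ℝ (k - 2 : ℕ) g (HeatPINN.cyl D T))
      (HeatPINN.ckNorm (k - 2) (HeatPINN.cyl D T) (HeatPINN.cyl D T)) yint wint Cint αint) :
    HeatPINN.genErr D T u (θ.fn σ) ≤
      HeatPINN.const1 T Cf *
        (HeatPINN.trainErr ytb wtb (HeatPINN.resTb ubar (θ.fn σ))
          + HeatPINN.trainErr yint wint (HeatPINN.resInt f (θ.fn σ))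
          + HeatPINN.const2 D T u (θ.fn σ)
            * (HeatPINN.trainErr ysb wsb (HeatPINN.resSb (θ.fn σ))) ^ (1 / 2 : ℝ)
          + (Ctb (HeatPINN.ckNorm k (closure D) (closure D)
                (fun x => HeatPINN.resTb ubar (θ.fn σ) x ^ 2))) ^ (1 / 2 : ℝ)
            * (Ntb : ℝ) ^ (-αtb / 2)
          + (Cint (HeatPINN.ckNorm (k - 2) (HeatPINN.cyl D T) (HeatPINN.cyl D T)
                (fun z => HeatPINN.resInt f (θ.fn σ) z ^ 2))) ^ (1 / 2 : ℝ)
            * (Nint : ℝ) ^ (-αint / 2)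
          + HeatPINN.const2 D T u (θ.fn σ)
            * (Csb (HeatPINN.surfaceCkNorm k (HeatPINN.lateral D T)
                (fun z => HeatPINN.resSb (θ.fn σ) z ^ 2))) ^ (1 / 4 : ℝ)
            * (Nsb : ℝ) ^ (-αsb / 4)) := by

  have hk1 : 1 ≤ k := by omega
  have hv : ContDiff ℝ k (θ.fn σ) := HeatPINN.Net.contDiff_fn hσ θ
  set v := θ.fn σ with hvdef
  have hU := hDk.uniqueDiffOn_cyl hk1 hDo hT
  have hQ := HeatPINN.isCompact_cyl (T := T) hDb
  have hk2 : ((2 : ℕ) : WithTop ℕ∞) ≤ k := by exact_mod_cast hk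
  have hk1' : ((1 : ℕ) : WithTop ℕ∞) ≤ k := by exact_mod_cast hk1
  have hCf : 0 ≤ Cf := by
    have h := (abs_nonneg _).trans (hf 1 0)
    simpa using h
  have hR : ContDiff ℝ (k - 2 : ℕ) (HeatPINN.resInt f v) := HeatPINN.contDiff_resInt hk hfk hv
  set w : HeatPINN.Pt d × ℝ → ℝ := fun z => v z - u z with hw
  have hwC : ContDiffOn ℝ 2 w (HeatPINN.cyl D T) :=
    (hv.contDiffOn.sub huk).of_le (by exact_mod_cast hk)
  have hreact : ∀ x ∈ D, ∀ t ∈ Set.Ioo 0 T, |deriv (fun s => w (x, s)) t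
      - Laplacian.laplacian (fun y => w (y, t)) x - HeatPINN.resInt f v (x, t)|
        ≤ Cf * |w (x, t)| := by
    intro x hx t ht
    have hv1 : ContDiffOn ℝ 1 v (HeatPINN.cyl D T) := hv.contDiffOn.of_le hk1'
    have h1 := HeatPINN.hasDerivAt_time hDo hv1 hx ht
    have h2 := HeatPINN.hasDerivAt_time hDo (huk.of_le hk1') hx ht
    have h3 : ∀ {g : HeatPINN.Pt d × ℝ → ℝ}, ContDiffOn ℝ k g (HeatPINN.cyl D T) →
        ContDiffAt ℝ 2 (fun y => g (y, t)) x := fun hg =>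
      (HeatPINN.contDiffOn_slice (hg.of_le hk2) ⟨ht.1.le, ht.2.le⟩ x
        (subset_closure hx)).contDiffAt (Filter.mem_of_superset (hDo.mem_nhds hx) subset_closure)
    have h4 : deriv (fun s => w (x, s)) t =
        deriv (fun s => v (x, s)) t - deriv (fun s => u (x, s)) t := by
      rw [h1.deriv, h2.deriv]; exact (h1.sub h2).deriv
    have h5 : Laplacian.laplacian (fun y => w (y, t)) x =
        Laplacian.laplacian (fun y => v (y, t)) x - Laplacian.laplacian (fun y => u (y, t)) x :=
      (h3 hv.contDiffOn).laplacian_sub (h3 huk)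
    rw [h4, h5, hu.pde x hx t ht, HeatPINN.resInt]
    -- By the equation for `u`, the expression in absolute values is f(v) - f(u), and the Lipschitz
    -- bound finishes.
    refine le_trans (le_of_eq ?_) (hf (v (x, t)) (u (x, t)))
    congr 1
    ring
  set M := HeatPINN.ckNorm 1 (HeatPINN.cyl D T) (HeatPINN.lateral D T) u +
    HeatPINN.ckNorm 1 (HeatPINN.cyl D T) (HeatPINN.lateral D T) v with hM
  have hM0 : 0 ≤ M := add_nonneg (HeatPINN.ckNorm_nonneg _ _ _ _) (HeatPINN.ckNorm_nonneg _ _ _ _)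
  have hMle : ∀ z ∈ HeatPINN.lateral D T,
      ‖fderivWithin ℝ w (HeatPINN.cyl D T) z‖ ≤ M := by
    intro z hz
    have hzQ := HeatPINN.lateral_subset_cyl hz
    have hv1 : ContDiffOn ℝ 1 v (HeatPINN.cyl D T) := hv.contDiffOn.of_le hk1'
    have hu1 : ContDiffOn ℝ 1 u (HeatPINN.cyl D T) := huk.of_le hk1'
    rw [hw, fderivWithin_fun_sub (hU z hzQ) (hv1.differentiableOn one_ne_zero z hzQ)
      (hu1.differentiableOn one_ne_zero z hzQ), hM, add_comm]
    exact (norm_sub_le _ _).trans (add_le_add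
      (HeatPINN.norm_fderivWithin_le_ckNorm hQ hU HeatPINN.lateral_subset_cyl hv1 hz)
      (HeatPINN.norm_fderivWithin_le_ckNorm hQ hU HeatPINN.lateral_subset_cyl hu1 hz))
  have hmain := HeatPINN.stability_estimate hk1 hDo hDb hDk hT hwC hR.continuous.continuousOn
    hCf hreact hM0 hMle
  have hgen : HeatPINN.genErr D T u v =
      √(∫ t in (0 : ℝ)..T, (∫ x in D, w (x, t) ^ 2)) := by
    simp only [HeatPINN.genErr, hw, sq_abs, sub_sq_comm]
  have htb : ∫ x in D, w (x, 0) ^ 2 = ∫ x in D, HeatPINN.resTb ubar v x ^ 2 :=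
    MeasureTheory.setIntegral_congr_fun hDo.measurableSet fun x hx => by
      simp only [hw, HeatPINN.resTb, hu.initial x hx]
  have hsb : ∫ t in (0 : ℝ)..T, (∫ x, w (x, t) ^ 2 ∂(HeatPINN.surfaceMeasure D)) =
      ∫ t in (0 : ℝ)..T, (∫ x, HeatPINN.resSb v (x, t) ^ 2 ∂(HeatPINN.surfaceMeasure D)) := by
    -- The boundary condition holds for t in the open interval only; the endpoints form a null set.
    rw [intervalIntegral.integral_of_le hT.le, intervalIntegral.integral_of_le hT.le,
      MeasureTheory.integral_Ioc_eq_integral_Ioo, MeasureTheory.integral_Ioc_eq_integral_Ioo]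
    refine MeasureTheory.setIntegral_congr_fun measurableSet_Ioo fun t ht => ?_
    refine MeasureTheory.setIntegral_congr_fun isClosed_frontier.measurableSet fun x hx => ?_
    simp only [hw, HeatPINN.resSb, hu.boundary x hx t ht, sub_zero]
  have qtb := (hQtb.sqrt_integral_sq_le hNtb (R := HeatPINN.resTb ubar v)
    (((hv.comp (contDiff_id.prodMk contDiff_const)).contDiffOn.sub hubar).pow 2)).1
  have qint := (hQint.sqrt_integral_sq_le hNint (R := HeatPINN.resInt f v)
    (hR.contDiffOn.pow 2)).1
  have qsb := (hQsb.sqrt_integral_sq_le hNsb (R := HeatPINN.resSb v)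
    ⟨fun z => v z ^ 2, hv.pow 2, fun z _ => rfl⟩).2
  beta_reduce at qtb qint qsb
  rw [← hgen, htb, hsb] at hmain
  -- With M the sum of the two C¹ norms, the coefficient of the boundary norm is C_∂D √T = C_2².
  have hc2 : √(M * (√((HeatPINN.surfaceMeasure D).real Set.univ) * √T *
      √(∫ t in (0 : ℝ)..T, (∫ x, HeatPINN.resSb v (x, t) ^ 2 ∂(HeatPINN.surfaceMeasure D))))) =
      HeatPINN.const2 D T u v * √√(∫ t in (0 : ℝ)..T,
        (∫ x, HeatPINN.resSb v (x, t) ^ 2 ∂(HeatPINN.surfaceMeasure D))) := by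
    rw [HeatPINN.const2, HeatPINN.constBd, ← hM, ← Real.sqrt_mul
      (by positivity : 0 ≤ √((HeatPINN.surfaceMeasure D).real Set.univ) * M * √T)]
    congr 1
    ring
  rw [hc2] at hmain
  refine hmain.trans (mul_le_mul_of_nonneg_left ?_ (Real.sqrt_nonneg _))
  have hc20 : 0 ≤ HeatPINN.const2 D T u v := Real.sqrt_nonneg _
  have hsb' := mul_le_mul_of_nonneg_left qsb hc20
  rw [mul_add, ← mul_assoc] at hsb'
  linarith
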